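/- Let $c>0$, and let $X=(X_n)_{n\ge 0}$ be the once-reinforced random walk on $\mathbb Z$ with parameter $c$, that is, the nearest neighbour process with $X_0=0$ such that, with $M_n=\max_{k\le n}X_k$ and $m_n=\min_{k\le n}X_k$, the conditional probability given $X_0,\dots,X_n$ that $X_{n+1}=X_n+1$ is $$\frac1{1+c}\ \text{ if } X_n=M_n\neq m_n,\qquad \frac{c}{1+c}\ \text{ if } X_n=m_n\neq M_n,\qquad \frac12\ \text{ otherwise},$$ and $X_{n+1}=X_n-1$ with the complementary conditional probability. (Equivalently, each neighbour of $X_n$ is chosen with probability proportional to $c$ if it was visited before time $n$, and to $1$ if not.) Let $R_n=M_n-m_n$ be its range at time $n$, and write $a_n\sim b_n$ if $a_n/b_n\to1$ as $n\to\infty$. Then for every $\ell=1,2,\dots$, as $n\to\infty$, $$\mathbb E\Big[\Big(\frac{R_n}{\sqrt n}\Big)^\ell\Big]\sim\frac{1}{2^{(\ell-2)/2}\,\Gamma(\ell/2)}\,J_\ell(c),\qquad J_\ell(c):=2^{2c}\int_0^\infty x^{\ell-1}\Big(\frac{e^x}{(e^x+1)^2}\Big)^c\,dx .$$ In particular, $\mathbb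 E[R_n/\sqrt n]\sim\sqrt{2/\pi}\,J_1(c)$ and $\mathbb E[R_n^2/n]\sim J_2(c)$. -/

import Mathlib

open MeasureTheory ProbabilityTheory Filter Topology

noncomputable section

/-- The running maximum `M_n = max_{k ≤ n} x_k` of a path. -/
def runMax (x : ℕ → ℤ) (n : ℕ) : ℤ :=
  (Finset.range (n + 1)).sup' Finset.nonempty_range_add_one x

/-- The running minimum `m_n = min_{k ≤ n} x_k` of a path. -/
def runMin (x : ℕ → ℤ) (n : ℕ) : ℤ :=
  (Finset.range (n + 1)).inf' Finset.nonempty_range_add_one x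

/-- The range `R_n = M_n - m_n` of a path. -/
def pathRange (x : ℕ → ℤ) (n : ℕ) : ℤ := runMax x n - runMin x n

/-- The conditional probability, given the path `x_0, …, x_n`, that once-reinforced random walk with
parameter `c` makes its next step upwards. If `x_n` is at once the maximum and the minimum, which for
a nearest neighbour path happens only at time `0`, then neither neighbour has been visited, and both
have the same weight. -/
def stepUpProb (c : ℝ) (x : ℕ → ℤ) (n : ℕ) : ℝ :=
  if x n = runMax x n then
    if x n = runMin x n then 1 / 2 else 1 / (1 + c)
  else if x n = runMin x n then c / (1 + c)
  else 1 / 2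

/-- `X` is (under `P`) a once-reinforced random walk on `ℤ` with parameter `c`. -/
structure IsOnceReinforcedRandomWalk {Ω : Type*} [MeasurableSpace Ω] (P : Measure Ω) (c : ℝ)
    (X : ℕ → Ω → ℤ) : Prop where
  measurable : ∀ n, Measurable (X n)
  start : ∀ᵐ ω ∂P, X 0 ω = 0
  step_up : ∀ (n : ℕ) (x : ℕ → ℤ), P {ω | ∀ k ≤ n, X k ω = x k} ≠ 0 →
    P[{ω | X (n + 1) ω = x n + 1} | {ω | ∀ k ≤ n, X k ω = x k}]
      = ENNReal.ofReal (stepUpProb c x n)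
  step_down : ∀ (n : ℕ) (x : ℕ → ℤ), P {ω | ∀ k ≤ n, X k ω = x k} ≠ 0 →
    P[{ω | X (n + 1) ω = x n - 1} | {ω | ∀ k ≤ n, X k ω = x k}]
      = ENNReal.ofReal (1 - stepUpProb c x n)

/-- `J_ℓ(c) = 2^{2c} ∫_0^∞ x^{ℓ-1} (e^x / (e^x + 1)^2)^c dx`. -/
def rangeJ (ℓ : ℕ) (c : ℝ) : ℝ :=
  (2 : ℝ) ^ (2 * c) *
    ∫ x in Set.Ioi (0 : ℝ), x ^ ((ℓ : ℝ) - 1) * (Real.exp x / (Real.exp x + 1) ^ 2) ^ c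

/-- `a_n ∼ b_n`, meaning `a_n / b_n → 1` as `n → ∞`. -/
def SeqEquiv (a b : ℕ → ℝ) : Prop := Tendsto (fun n => a n / b n) atTop (𝓝 1)

end

/-! Let `T_r` be the time at which the range reaches `r`, and put `s = 1 / cosh t`. Inside the
visited interval the walk is simple, and `cosh (t y)`, with `y` measured from the midpoint, is an
eigenfunction of its one-step mean with eigenvalue `cosh t`. Matching at the two endpoints, where
the reinforced steps occur, gives an explicit product: `E[s^{T_r}] = ∏_{k<r} (cosh t + c sinh t tanh
(t k / 2))⁻¹`, which is `passageGF` (`stepMean_passagePotential`, `hasSum_pow_mul_tail`).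

The sum `∑ s^n P(R_n ≥ r)` equals `E[s^{T_r}] / (1 - s)`. Summing over `r = j + 1` with weights
`(j+1)^ℓ - j^ℓ` yields `∑ s^n E[R_n^ℓ]` exactly (`hasSum_pow_mul_moment`).

As `t → 0` with `r ≈ x / t`, the logarithm of the product is close to `-c ∫_0^x tanh (u/2) du = -2c
log cosh (x/2)`. So `E[s^{T_r}]` tends to `cosh (x/2)^(-2c)`, which is `2^{2c} (e^x/(e^x+1)^2)^c`.
By dominated convergence `t^ℓ (1 - s) ∑ s^n E[R_n^ℓ]` tends to `ℓ J_ℓ(c)`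
(`tendsto_integral_passageIntegrand`).

With `s = e^{-δ}` one has `δ = log cosh t ∼ t²/2`. Since `E[R_n^ℓ]` is nondecreasing in `n`,
Karamata's theorem (`tendsto_div_rpow_of_tendsto_abel`) transfers this to `E[R_n^ℓ]` itself. -/

/-! ### Karamata's Tauberian theorem -/

/-- The weighted Abel sum `δ^{ρ+1} ∑ aₙ e^{-δn} g(e^{-δn})`. -/
noncomputable def abelSum (a : ℕ → ℝ) (ρ : ℝ) (g : ℝ → ℝ) (δ : ℝ) : ℝ :=
  δ ^ (ρ + 1) * ∑' n : ℕ, a n * (Real.exp (-(δ * n)) * g (Real.exp (-(δ * n))))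

/-- The limit functional `∫₀^∞ x^ρ e^{-x} g(e^{-x}) dx`. -/
noncomputable def abelInt (ρ : ℝ) (g : ℝ → ℝ) : ℝ :=
  ∫ x in Set.Ioi (0 : ℝ), x ^ ρ * (Real.exp (-x) * g (Real.exp (-x)))

lemma exp_neg_mem_Icc {x : ℝ} (hx : 0 ≤ x) : Real.exp (-x) ∈ Set.Icc (0 : ℝ) 1 :=
  ⟨(Real.exp_pos _).le, Real.exp_le_one_iff.2 (by linarith)⟩

lemma exists_bound_Icc {g : ℝ → ℝ} (hg : Continuous g) :
    ∃ B, ∀ u ∈ Set.Icc (0 : ℝ) 1, |g u| ≤ B := by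
  obtain ⟨B, hB⟩ := (isCompact_Icc (a := (0 : ℝ)) (b := 1)).exists_bound_of_continuousOn
    hg.continuousOn
  exact ⟨B, fun u hu => by simpa using hB u hu⟩

lemma integrableOn_rpow_mul_exp_neg {ρ : ℝ} (hρ : 0 ≤ ρ) :
    IntegrableOn (fun x : ℝ => x ^ ρ * Real.exp (-x)) (Set.Ioi 0) := by
  have := Real.GammaIntegral_convergent (s := ρ + 1) (by linarith)
  simpa [mul_comm] using this

lemma integral_rpow_mul_exp_neg_eq {ρ : ℝ} (hρ : 0 ≤ ρ) :
    ∫ x in Set.Ioi (0 : ℝ), x ^ ρ * Real.exp (-x) = Real.Gamma (ρ + 1) := by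
  rw [Real.Gamma_eq_integral (by linarith)]
  simp [mul_comm]

lemma integrableOn_abelInt {ρ : ℝ} (hρ : 0 ≤ ρ) {g : ℝ → ℝ} (hg : Continuous g) :
    IntegrableOn (fun x : ℝ => x ^ ρ * (Real.exp (-x) * g (Real.exp (-x)))) (Set.Ioi 0) := by
  obtain ⟨B, hB⟩ := exists_bound_Icc hg
  have h1 := (integrableOn_rpow_mul_exp_neg hρ)
  have := Integrable.mul_bdd (c := B) h1
    (g := fun x => g (Real.exp (-x))) (by fun_prop) (by
      filter_upwards [ae_restrict_mem measurableSet_Ioi] with x hx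
      exact hB _ (exp_neg_mem_Icc (le_of_lt hx)))
  simpa [mul_assoc, IntegrableOn] using this

lemma summable_abelSum {a : ℕ → ℝ} (ha : ∀ n, 0 ≤ a n) {δ : ℝ} (hδ : 0 < δ)
    (hs : Summable fun n : ℕ => a n * Real.exp (-(δ * n))) {g : ℝ → ℝ} (hg : Continuous g) :
    Summable fun n : ℕ => a n * (Real.exp (-(δ * n)) * g (Real.exp (-(δ * n)))) := by
  obtain ⟨B, hB⟩ := exists_bound_Icc hg
  refine Summable.of_norm_bounded (hs.mul_left B) fun n => ?_
  have := hB _ (exp_neg_mem_Icc (x := δ * n) (by positivity))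
  rw [Real.norm_eq_abs, abs_mul, abs_mul, abs_of_nonneg (ha n), Real.abs_exp]
  have h2 : 0 ≤ a n * Real.exp (-(δ * n)) := mul_nonneg (ha n) (Real.exp_pos _).le
  nlinarith

lemma abelSum_add {a : ℕ → ℝ} (ha : ∀ n, 0 ≤ a n) (ρ : ℝ) {δ : ℝ} (hδ : 0 < δ)
    (hs : Summable fun n : ℕ => a n * Real.exp (-(δ * n))) {g h : ℝ → ℝ} (hg : Continuous g)
    (hh : Continuous h) : abelSum a ρ (g + h) δ = abelSum a ρ g δ + abelSum a ρ h δ := by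
  unfold abelSum
  rw [← mul_add, ← (summable_abelSum ha hδ hs hg).tsum_add (summable_abelSum ha hδ hs hh)]
  simp [mul_add]

lemma abelInt_add {ρ : ℝ} (hρ : 0 ≤ ρ) {g h : ℝ → ℝ} (hg : Continuous g) (hh : Continuous h) :
    abelInt ρ (g + h) = abelInt ρ g + abelInt ρ h := by
  unfold abelInt
  rw [← integral_add (integrableOn_abelInt hρ hg) (integrableOn_abelInt hρ hh)]
  simp [mul_add]

lemma abs_abelSum_sub_le {a : ℕ → ℝ} (ha : ∀ n, 0 ≤ a n) (ρ : ℝ) {δ : ℝ} (hδ : 0 < δ)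
    (hs : Summable fun n : ℕ => a n * Real.exp (-(δ * n))) {g h : ℝ → ℝ} (hg : Continuous g)
    (hh : Continuous h) {ε : ℝ} (hgh : ∀ u ∈ Set.Icc (0 : ℝ) 1, |g u - h u| ≤ ε) :
    |abelSum a ρ g δ - abelSum a ρ h δ| ≤
      ε * (δ ^ (ρ + 1) * ∑' n : ℕ, a n * Real.exp (-(δ * n))) := by
  unfold abelSum
  have h1 := summable_abelSum ha hδ hs hg
  have h2 := summable_abelSum ha hδ hs hh
  have hp : 0 ≤ δ ^ (ρ + 1) := Real.rpow_nonneg hδ.le _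
  rw [← mul_sub, ← h1.tsum_sub h2, abs_mul, abs_of_nonneg hp, mul_left_comm, ← tsum_mul_left]
  refine mul_le_mul_of_nonneg_left ?_ hp
  rw [← Real.norm_eq_abs]
  refine tsum_of_norm_bounded (hs.mul_left ε).hasSum fun n => ?_
  have := hgh _ (exp_neg_mem_Icc (x := δ * n) (by positivity))
  have h2 : 0 ≤ a n * Real.exp (-(δ * n)) := mul_nonneg (ha n) (Real.exp_pos _).le
  rw [← mul_sub, ← mul_sub, ← mul_assoc, norm_mul, Real.norm_of_nonneg h2, mul_comm]
  exact mul_le_mul_of_nonneg_right this h2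

lemma abs_abelInt_sub_le {ρ : ℝ} (hρ : 0 ≤ ρ) {g h : ℝ → ℝ} (hg : Continuous g)
    (hh : Continuous h) {ε : ℝ} (hgh : ∀ u ∈ Set.Icc (0 : ℝ) 1, |g u - h u| ≤ ε) :
    |abelInt ρ g - abelInt ρ h| ≤ ε * Real.Gamma (ρ + 1) := by
  unfold abelInt
  rw [← integral_sub (integrableOn_abelInt hρ hg) (integrableOn_abelInt hρ hh),
    ← integral_rpow_mul_exp_neg_eq hρ, ← integral_const_mul, ← Real.norm_eq_abs]
  refine norm_integral_le_of_norm_le ((integrableOn_rpow_mul_exp_neg hρ).const_mul ε) ?_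
  filter_upwards [ae_restrict_mem measurableSet_Ioi] with x hx
  have hx' : (0 : ℝ) ≤ x := le_of_lt hx
  have := hgh _ (exp_neg_mem_Icc hx')
  have h2 : 0 ≤ x ^ ρ * Real.exp (-x) := by positivity
  rw [← mul_sub, ← mul_sub, ← mul_assoc, norm_mul, Real.norm_of_nonneg h2, mul_comm]
  exact mul_le_mul_of_nonneg_right this h2

/-- The weight `e^{-δn} (e^{-δn})^k` is `e^{-(k+1)δn}`, so this is the hypothesis at `(k+1)δ`. The
resulting factor `(k+1)^{-(ρ+1)}` is the one that the substitution `x ↦ (k+1)x` produces in the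
Gamma integral. -/
lemma tendsto_abelSum_monomial {a : ℕ → ℝ} {ρ C : ℝ} (hρ : 0 ≤ ρ)
    (h : Tendsto (fun δ : ℝ => δ ^ (ρ + 1) * ∑' n : ℕ, a n * Real.exp (-(δ * n))) (𝓝[>] 0) (𝓝 C))
    (b : ℝ) (k : ℕ) :
    Tendsto (abelSum a ρ fun u => b * u ^ k) (𝓝[>] 0)
      (𝓝 (C / Real.Gamma (ρ + 1) * abelInt ρ fun u => b * u ^ k)) := by
  have hk : (0 : ℝ) < k + 1 := by positivity
  have hG : Real.Gamma (ρ + 1) ≠ 0 := (Real.Gamma_pos_of_pos (by linarith)).ne'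
  have hI : abelInt ρ (fun u => b * u ^ k) = b * ((1 / (k + 1 : ℝ)) ^ (ρ + 1) * Real.Gamma (ρ + 1)) := by
    rw [← Real.integral_rpow_mul_exp_neg_mul_Ioi (a := ρ + 1) (by linarith) hk, abelInt,
      ← integral_const_mul]
    congr 1
    ext x
    rw [← Real.exp_nat_mul, add_sub_cancel_right, show -((k + 1 : ℝ) * x) = -x + k * -x by ring,
      Real.exp_add]
    ring
  have ht : Tendsto (fun δ : ℝ => (k + 1 : ℝ) * δ) (𝓝[>] 0) (𝓝[>] 0) := by
    refine tendsto_nhdsWithin_iff.2 ⟨?_, ?_⟩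
    · have : Tendsto (fun δ : ℝ => (k + 1 : ℝ) * δ) (𝓝 0) (𝓝 ((k + 1 : ℝ) * 0)) :=
        tendsto_id.const_mul _
      rw [mul_zero] at this
      exact this.mono_left nhdsWithin_le_nhds
    · filter_upwards [self_mem_nhdsWithin] with δ hδ
      exact mul_pos hk hδ
  have h2 := (h.comp ht).const_mul (b * (1 / (k + 1 : ℝ)) ^ (ρ + 1))
  rw [hI, show C / Real.Gamma (ρ + 1) * (b * ((1 / (k + 1 : ℝ)) ^ (ρ + 1) * Real.Gamma (ρ + 1)))
    = b * (1 / (k + 1 : ℝ)) ^ (ρ + 1) * C by field_simp]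
  refine h2.congr' ?_
  filter_upwards [self_mem_nhdsWithin] with δ hδ
  have hδ' : (0 : ℝ) < δ := hδ
  simp only [Function.comp, abelSum]
  have e1 : (1 / (k + 1 : ℝ)) ^ (ρ + 1) * ((k + 1 : ℝ) * δ) ^ (ρ + 1) = δ ^ (ρ + 1) := by
    rw [← Real.mul_rpow (by positivity) (by positivity)]
    congr 1
    field_simp
  have e2 : ∑' n : ℕ, a n * (Real.exp (-(δ * n)) * (b * Real.exp (-(δ * n)) ^ k))
      = b * ∑' n : ℕ, a n * Real.exp (-((k + 1 : ℝ) * δ * n)) := by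
    rw [← tsum_mul_left]
    congr 1
    ext n
    rw [← Real.exp_nat_mul, show -((k + 1 : ℝ) * δ * n) = -(δ * n) + k * -(δ * n) by ring,
      Real.exp_add]
    ring
  rw [e2, ← e1]
  ring

lemma tendsto_abelSum_polynomial {a : ℕ → ℝ} (ha : ∀ n, 0 ≤ a n) {ρ C : ℝ} (hρ : 0 ≤ ρ)
    (hs : ∀ δ : ℝ, 0 < δ → Summable fun n : ℕ => a n * Real.exp (-(δ * n)))
    (h : Tendsto (fun δ : ℝ => δ ^ (ρ + 1) * ∑' n : ℕ, a n * Real.exp (-(δ * n))) (𝓝[>] 0) (𝓝 C))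
    (p : Polynomial ℝ) :
    Tendsto (abelSum a ρ fun u => p.eval u) (𝓝[>] 0)
      (𝓝 (C / Real.Gamma (ρ + 1) * abelInt ρ fun u => p.eval u)) := by
  induction p using Polynomial.induction_on' with
  | add p q hp hq =>
    have e : (fun u => (p + q).eval u) = (fun u => p.eval u) + fun u => q.eval u := by
      ext u; simp
    rw [e, abelInt_add hρ p.continuous q.continuous, mul_add]
    refine (hp.add hq).congr' ?_
    filter_upwards [self_mem_nhdsWithin] with δ hδ
    exact (abelSum_add ha ρ hδ (hs δ hδ) p.continuous q.continuous).symm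
  | monomial k b =>
    simpa using tendsto_abelSum_monomial hρ h b k

/-- Weierstrass approximation on `[0, 1]`: sums and integrals both depend on `g` in a Lipschitz way
for the uniform norm, so the polynomial case suffices. -/
lemma tendsto_abelSum {a : ℕ → ℝ} (ha : ∀ n, 0 ≤ a n) {ρ C : ℝ} (hρ : 0 ≤ ρ)
    (hs : ∀ δ : ℝ, 0 < δ → Summable fun n : ℕ => a n * Real.exp (-(δ * n)))
    (h : Tendsto (fun δ : ℝ => δ ^ (ρ + 1) * ∑' n : ℕ, a n * Real.exp (-(δ * n))) (𝓝[>] 0) (𝓝 C))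
    {g : ℝ → ℝ} (hg : Continuous g) :
    Tendsto (abelSum a ρ g) (𝓝[>] 0) (𝓝 (C / Real.Gamma (ρ + 1) * abelInt ρ g)) := by
  have hG : 0 < Real.Gamma (ρ + 1) := Real.Gamma_pos_of_pos (by linarith)
  have hC : 0 ≤ C := by
    refine ge_of_tendsto h ?_
    filter_upwards [self_mem_nhdsWithin] with δ hδ
    exact mul_nonneg (Real.rpow_nonneg (le_of_lt hδ) _)
      (tsum_nonneg fun n => mul_nonneg (ha n) (Real.exp_pos _).le)
  rw [Metric.tendsto_nhds]
  intro η hη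
  -- Near `δ = 0` the total Abel mass is below `C + 1`, so each of the three errors is at most `η /
  -- 3`.
  set ε := η / (3 * (C + 1)) with hε
  have hε0 : 0 < ε := by positivity
  obtain ⟨p, hp⟩ := exists_polynomial_near_of_continuousOn 0 1 g hg.continuousOn ε hε0
  have hp1 : ∀ u ∈ Set.Icc (0 : ℝ) 1, |g u - p.eval u| ≤ ε := fun u hu => by
    rw [abs_sub_comm]; exact (hp u hu).le
  have hint := abs_abelInt_sub_le hρ hg p.continuous hp1
  filter_upwards [self_mem_nhdsWithin, h.eventually (gt_mem_nhds (lt_add_one C)),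
    Metric.tendsto_nhds.1 (tendsto_abelSum_polynomial ha hρ hs h p) (η / 3) (by positivity)]
    with δ hδ h1 h2
  have h3 := abs_abelSum_sub_le ha ρ hδ (hs δ hδ) hg p.continuous hp1
  rw [Real.dist_eq] at h2 ⊢
  have e1 : ε * (C + 1) = η / 3 := by rw [hε]; field_simp
  have h4 : ε * (δ ^ (ρ + 1) * ∑' n : ℕ, a n * Real.exp (-(δ * n))) ≤ η / 3 := by
    rw [← e1]; exact mul_le_mul_of_nonneg_left h1.le hε0.le
  have h5 : |C / Real.Gamma (ρ + 1) * abelInt ρ g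
      - C / Real.Gamma (ρ + 1) * abelInt ρ fun u => p.eval u| ≤ ε * C := by
    rw [← mul_sub, abs_mul, abs_of_nonneg (by positivity)]
    calc _ ≤ C / Real.Gamma (ρ + 1) * (ε * Real.Gamma (ρ + 1)) := by gcongr
      _ = ε * C := by field_simp
  have h6 : ε * C < η / 3 := by rw [← e1]; nlinarith
  rw [abs_lt] at h2 ⊢
  rw [abs_le] at h3 h5
  constructor <;> linarith

/-- A continuous bump whose composition with `x ↦ e^{-x}` is supported in `[A, B]`. -/
noncomputable def expBump (A B u : ℝ) : ℝ := max 0 ((u - Real.exp (-B)) * (Real.exp (-A) - u))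

lemma continuous_expBump (A B : ℝ) : Continuous (expBump A B) := by
  unfold expBump; fun_prop

lemma expBump_nonneg (A B u : ℝ) : 0 ≤ expBump A B u := le_max_left _ _

lemma expBump_eq_zero {A B x : ℝ} (hAB : A < B) (hx : x ≤ A ∨ B ≤ x) :
    expBump A B (Real.exp (-x)) = 0 := by
  have h0 : Real.exp (-B) < Real.exp (-A) := Real.exp_lt_exp.2 (by linarith)
  refine max_eq_left ?_
  rcases hx with hx | hx
  · have : Real.exp (-A) ≤ Real.exp (-x) := Real.exp_le_exp.2 (by linarith)
    exact mul_nonpos_of_nonneg_of_nonpos (by linarith) (by linarith)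
  · have : Real.exp (-x) ≤ Real.exp (-B) := Real.exp_le_exp.2 (by linarith)
    exact mul_nonpos_of_nonpos_of_nonneg (by linarith) (by linarith)

lemma expBump_pos {A B x : ℝ} (hA : A < x) (hB : x < B) : 0 < expBump A B (Real.exp (-x)) :=
  lt_max_of_lt_right (mul_pos (sub_pos.2 (Real.exp_lt_exp.2 (by linarith)))
    (sub_pos.2 (Real.exp_lt_exp.2 (by linarith))))

lemma abelInt_zero_expBump_pos {A B : ℝ} (hA : 0 ≤ A) (hAB : A < B) :
    0 < abelInt 0 (expBump A B) := by
  unfold abelInt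
  rw [setIntegral_pos_iff_support_of_nonneg_ae]
  · have : Set.Ioo A B ⊆ (Function.support fun x : ℝ => x ^ (0 : ℝ) *
        (Real.exp (-x) * expBump A B (Real.exp (-x)))) ∩ Set.Ioi 0 := by
      intro x hx
      refine ⟨?_, lt_of_le_of_lt hA hx.1⟩
      have h1 := expBump_pos hx.1 hx.2
      have h2 := Real.exp_pos (-x)
      simp only [Function.mem_support, Real.rpow_zero, one_mul]
      positivity
    exact lt_of_lt_of_le (by simpa using hAB) (measure_mono this)
  · filter_upwards with x
    have h1 := expBump_nonneg A B (Real.exp (-x))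
    simp only [Pi.zero_apply, Real.rpow_zero, one_mul]
    positivity
  · exact integrableOn_abelInt le_rfl (continuous_expBump A B)

lemma abelInt_expBump_le {ρ A B : ℝ} (hρ : 0 ≤ ρ) (hAB : A < B) :
    abelInt ρ (expBump A B) ≤ B ^ ρ * abelInt 0 (expBump A B) := by
  unfold abelInt
  rw [← integral_const_mul]
  refine setIntegral_mono_on (integrableOn_abelInt hρ (continuous_expBump A B))
    ((integrableOn_abelInt le_rfl (continuous_expBump A B)).const_mul _) measurableSet_Ioi ?_
  intro x hx
  have h1 := expBump_nonneg A B (Real.exp (-x))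
  rcases le_or_gt B x with h | h
  · simp [expBump_eq_zero hAB (Or.inr h)]
  · rw [Real.rpow_zero, one_mul]
    exact mul_le_mul_of_nonneg_right (Real.rpow_le_rpow (le_of_lt hx) h.le hρ) (by positivity)

lemma le_abelInt_expBump {ρ A B : ℝ} (hρ : 0 ≤ ρ) (hA : 0 ≤ A) (hAB : A < B) :
    A ^ ρ * abelInt 0 (expBump A B) ≤ abelInt ρ (expBump A B) := by
  unfold abelInt
  rw [← integral_const_mul]
  refine setIntegral_mono_on ((integrableOn_abelInt le_rfl (continuous_expBump A B)).const_mul _)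
    (integrableOn_abelInt hρ (continuous_expBump A B)) measurableSet_Ioi ?_
  intro x hx
  have h1 := expBump_nonneg A B (Real.exp (-x))
  rcases le_or_gt x A with h | h
  · simp [expBump_eq_zero hAB (Or.inl h)]
  · rw [Real.rpow_zero, one_mul]
    exact mul_le_mul_of_nonneg_right (Real.rpow_le_rpow hA h.le hρ) (by positivity)

lemma summable_exp_neg_mul {δ : ℝ} (hδ : 0 < δ) : Summable fun n : ℕ => Real.exp (-(δ * n)) := by
  have := Real.summable_exp_nat_mul_iff.2 (neg_lt_zero.2 hδ)
  refine this.congr fun n => ?_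
  ring_nf

lemma tsum_exp_neg_mul {δ : ℝ} (hδ : 0 < δ) :
    ∑' n : ℕ, Real.exp (-(δ * n)) = (1 - Real.exp (-δ))⁻¹ := by
  rw [← tsum_geometric_of_lt_one (Real.exp_pos _).le (Real.exp_lt_one_iff.2 (by linarith))]
  congr 1
  ext n
  rw [← Real.exp_nat_mul]
  ring_nf

lemma tendsto_div_one_sub_exp_neg :
    Tendsto (fun δ : ℝ => δ * (1 - Real.exp (-δ))⁻¹) (𝓝[>] 0) (𝓝 1) := by
  have h1 : HasDerivAt (fun δ : ℝ => 1 - Real.exp (-δ)) 1 0 := by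
    have := ((hasDerivAt_id (0 : ℝ)).neg.exp).const_sub 1
    simpa using this
  have h2 := h1.tendsto_slope_zero_right
  have h3 := h2.inv₀ one_ne_zero
  rw [inv_one] at h3
  refine h3.congr fun δ => ?_
  simp [mul_comm]

/-- **Karamata's Tauberian theorem** for power series with monotone nonnegative coefficients. -/
theorem tendsto_div_rpow_of_tendsto_abel {a : ℕ → ℝ} (ha : ∀ n, 0 ≤ a n) (hm : Monotone a)
    {ρ C : ℝ} (hρ : 0 ≤ ρ)
    (hs : ∀ δ : ℝ, 0 < δ → Summable fun n : ℕ => a n * Real.exp (-(δ * n)))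
    (h : Tendsto (fun δ : ℝ => δ ^ (ρ + 1) * ∑' n : ℕ, a n * Real.exp (-(δ * n))) (𝓝[>] 0) (𝓝 C)) :
    Tendsto (fun n : ℕ => a n / (n : ℝ) ^ ρ) atTop (𝓝 (C / Real.Gamma (ρ + 1))) := by
  have hG : 0 < Real.Gamma (ρ + 1) := Real.Gamma_pos_of_pos (by linarith)
  have hC : 0 ≤ C := by
    refine ge_of_tendsto h ?_
    filter_upwards [self_mem_nhdsWithin] with δ hδ
    exact mul_nonneg (Real.rpow_nonneg (le_of_lt hδ) _)
      (tsum_nonneg fun n => mul_nonneg (ha n) (Real.exp_pos _).le)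
  set K := C / Real.Gamma (ρ + 1) with hK
  have hK0 : 0 ≤ K := by positivity
  have hs1 : ∀ δ : ℝ, 0 < δ → Summable fun n : ℕ => (1 : ℝ) * Real.exp (-(δ * n)) := fun δ hδ => by
    simpa using summable_exp_neg_mul hδ
  have h1 : Tendsto (fun δ : ℝ => δ ^ ((0 : ℝ) + 1) * ∑' n : ℕ, (1 : ℝ) * Real.exp (-(δ * n)))
      (𝓝[>] 0) (𝓝 1) := by
    refine tendsto_div_one_sub_exp_neg.congr' ?_
    filter_upwards [self_mem_nhdsWithin] with δ hδ
    simp [tsum_exp_neg_mul hδ]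
  have hinv : Tendsto (fun n : ℕ => ((n : ℝ))⁻¹) atTop (𝓝[>] 0) :=
    tendsto_inv_atTop_nhdsGT_zero.comp tendsto_natCast_atTop_atTop
  -- Dividing by the same sum for the constant sequence `1` removes the shape of the bump: the ratio
  -- is a weighted average of `x^ρ` over `[A, B]`, times `K`.
  have hlim : ∀ A B : ℝ, 0 ≤ A → A < B →
      Tendsto (fun n : ℕ => abelSum a ρ (expBump A B) (n : ℝ)⁻¹ /
        abelSum (fun _ => 1) 0 (expBump A B) (n : ℝ)⁻¹) atTop
        (𝓝 (K * abelInt ρ (expBump A B) / abelInt 0 (expBump A B))) := by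
    intro A B hA hAB
    have t1 := (tendsto_abelSum ha hρ hs h (continuous_expBump A B)).comp hinv
    have t2 := (tendsto_abelSum (fun _ => zero_le_one) le_rfl hs1 h1
      (continuous_expBump A B)).comp hinv
    have t3 := t1.div t2 (by
      have := abelInt_zero_expBump_pos hA hAB
      simp [Real.Gamma_one, this.ne'])
    simpa [Real.Gamma_one, Function.comp_def, Pi.div_def] using t3
  have hpos : ∀ A B : ℝ, 0 ≤ A → A < B →
      ∀ᶠ n : ℕ in atTop, 0 < abelSum (fun _ => 1) 0 (expBump A B) (n : ℝ)⁻¹ := by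
    intro A B hA hAB
    have t2 := (tendsto_abelSum (fun _ => zero_le_one) le_rfl hs1 h1
      (continuous_expBump A B)).comp hinv
    refine t2.eventually (lt_mem_nhds ?_)
    simpa [Real.Gamma_one] using abelInt_zero_expBump_pos hA hAB
  have hcmp : ∀ n : ℕ, 0 < n → ∀ A B : ℝ,
      a n / (n : ℝ) ^ ρ * abelSum (fun _ => 1) 0 (expBump A B) (n : ℝ)⁻¹ =
        ((n : ℝ)⁻¹) ^ (ρ + 1) * ∑' k : ℕ, a n * (Real.exp (-((n : ℝ)⁻¹ * k)) *
          expBump A B (Real.exp (-((n : ℝ)⁻¹ * k)))) := by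
    intro n hn A B
    have hn' : (0 : ℝ) < n := by exact_mod_cast hn
    rw [abelSum, Real.rpow_add (by positivity) ρ 1]
    simp only [one_mul, zero_add, tsum_mul_left, Real.inv_rpow hn'.le, Real.rpow_one]
    ring
  have hsn : ∀ n : ℕ, 0 < n → ∀ A B : ℝ,
      Summable fun k : ℕ => a n * (Real.exp (-((n : ℝ)⁻¹ * k)) *
          expBump A B (Real.exp (-((n : ℝ)⁻¹ * k)))) := by
    intro n hn A B
    have hn' : (0 : ℝ) < (n : ℝ)⁻¹ := by positivity
    exact summable_abelSum (fun _ => ha n) hn' ((summable_exp_neg_mul hn').mul_left _)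
      (continuous_expBump A B)
  refine tendsto_order.2 ⟨fun y hy => ?_, fun y hy => ?_⟩
  -- Lower bound: use a bump on `[A, 1]` with `A` just below `1` and `δ = 1/n`. Only terms with `k <
  -- n` survive, and there `a k ≤ a n`.
  · obtain ⟨A, hyA, hA⟩ : ∃ A : ℝ, y < K * A ^ ρ ∧ A ∈ Set.Ico (0 : ℝ) 1 := by
      have : ContinuousAt (fun A : ℝ => K * A ^ ρ) 1 :=
        continuousAt_const.mul (Real.continuousAt_rpow_const _ _ (Or.inl one_ne_zero))
      have h2 : ∀ᶠ A in 𝓝[<] (1 : ℝ), y < K * A ^ ρ :=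
        (this.tendsto.mono_left nhdsWithin_le_nhds).eventually (lt_mem_nhds (by simpa using hy))
      exact (h2.and (Ico_mem_nhdsLT zero_lt_one)).exists
    have hI := abelInt_zero_expBump_pos hA.1 hA.2
    have hlt : y < K * abelInt ρ (expBump A 1) / abelInt 0 (expBump A 1) := by
      refine hyA.trans_le ?_
      rw [le_div_iff₀ hI, mul_assoc]
      exact mul_le_mul_of_nonneg_left (le_abelInt_expBump hρ hA.1 hA.2) hK0
    filter_upwards [(hlim A 1 hA.1 hA.2).eventually (lt_mem_nhds hlt), hpos A 1 hA.1 hA.2,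
      eventually_gt_atTop 0] with n h2 h3 hn
    refine h2.trans_le ?_
    have hn' : (0 : ℝ) < n := by exact_mod_cast hn
    rw [div_le_iff₀ h3, hcmp n hn]
    refine mul_le_mul_of_nonneg_left ?_ (by positivity)
    refine Summable.tsum_le_tsum (fun k => ?_) (summable_abelSum ha (by positivity)
      (hs _ (by positivity)) (continuous_expBump A 1)) (hsn n hn A 1)
    rcases le_or_gt n k with hk | hk
    · rw [expBump_eq_zero hA.2]
      · simp
      · right
        rw [inv_mul_eq_div, one_le_div hn']
        exact_mod_cast hk
    · exact mul_le_mul_of_nonneg_right (hm hk.le)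
        (mul_nonneg (Real.exp_pos _).le (expBump_nonneg _ _ _))
  -- Upper bound: a bump on `[1, B]` keeps only the terms with `k > n`, where `a n ≤ a k`.
  · obtain ⟨B, hyB, hB⟩ : ∃ B : ℝ, K * B ^ ρ < y ∧ 1 < B := by
      have : ContinuousAt (fun A : ℝ => K * A ^ ρ) 1 :=
        continuousAt_const.mul (Real.continuousAt_rpow_const _ _ (Or.inl one_ne_zero))
      have h2 : ∀ᶠ A in 𝓝[>] (1 : ℝ), K * A ^ ρ < y :=
        (this.tendsto.mono_left nhdsWithin_le_nhds).eventually (gt_mem_nhds (by simpa using hy))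
      exact (h2.and self_mem_nhdsWithin).exists
    have hI := abelInt_zero_expBump_pos zero_le_one hB
    have hlt : K * abelInt ρ (expBump 1 B) / abelInt 0 (expBump 1 B) < y := by
      refine lt_of_le_of_lt ?_ hyB
      rw [div_le_iff₀ hI, mul_assoc]
      exact mul_le_mul_of_nonneg_left (abelInt_expBump_le hρ hB) hK0
    filter_upwards [(hlim 1 B zero_le_one hB).eventually (gt_mem_nhds hlt),
      hpos 1 B zero_le_one hB, eventually_gt_atTop 0] with n h2 h3 hn
    refine lt_of_le_of_lt ?_ h2
    have hn' : (0 : ℝ) < n := by exact_mod_cast hn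
    rw [le_div_iff₀ h3, hcmp n hn]
    refine mul_le_mul_of_nonneg_left ?_ (by positivity)
    refine Summable.tsum_le_tsum (fun k => ?_) (hsn n hn 1 B) (summable_abelSum ha (by positivity)
      (hs _ (by positivity)) (continuous_expBump 1 B))
    rcases le_or_gt k n with hk | hk
    · rw [expBump_eq_zero hB]
      · simp
      · left
        rw [inv_mul_eq_div, div_le_one hn']
        exact_mod_cast hk
    · exact mul_le_mul_of_nonneg_right (hm hk.le)
        (mul_nonneg (Real.exp_pos _).le (expBump_nonneg _ _ _))

/-! ### Running extrema and the Markov property -/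

lemma runMax_succ (x : ℕ → ℤ) (n : ℕ) : runMax x (n + 1) = max (runMax x n) (x (n + 1)) := by
  rw [max_comm]
  exact (Finset.sup'_congr _ Finset.range_add_one fun _ _ => rfl).trans (Finset.sup'_insert _ _)

lemma runMin_succ (x : ℕ → ℤ) (n : ℕ) : runMin x (n + 1) = min (runMin x n) (x (n + 1)) := by
  rw [min_comm]
  exact (Finset.inf'_congr _ Finset.range_add_one fun _ _ => rfl).trans (Finset.inf'_insert _ _)

lemma runMax_congr {x y : ℕ → ℤ} {n : ℕ} (h : ∀ k ≤ n, x k = y k) : runMax x n = runMax y n :=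
  Finset.sup'_congr _ rfl fun k hk => h k (by simpa [Nat.lt_succ_iff] using hk)

lemma runMin_congr {x y : ℕ → ℤ} {n : ℕ} (h : ∀ k ≤ n, x k = y k) : runMin x n = runMin y n :=
  Finset.inf'_congr _ rfl fun k hk => h k (by simpa [Nat.lt_succ_iff] using hk)

lemma le_runMax (x : ℕ → ℤ) (n : ℕ) : x n ≤ runMax x n :=
  Finset.le_sup' x (by simp)

lemma runMin_le (x : ℕ → ℤ) (n : ℕ) : runMin x n ≤ x n :=
  Finset.inf'_le x (by simp)

lemma stepUpProb_congr (c : ℝ) {x y : ℕ → ℤ} {n : ℕ} (h : ∀ k ≤ n, x k = y k) :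
    stepUpProb c x n = stepUpProb c y n := by
  simp only [stepUpProb, runMax_congr h, runMin_congr h, h n le_rfl]

lemma stepUpProb_mem_Icc {c : ℝ} (hc : 0 < c) (x : ℕ → ℤ) (n : ℕ) :
    stepUpProb c x n ∈ Set.Icc (0 : ℝ) 1 := by
  unfold stepUpProb
  split_ifs
  · norm_num
  · exact ⟨by positivity, by rw [div_le_one] <;> linarith⟩
  · exact ⟨by positivity, by rw [div_le_one] <;> linarith⟩
  · norm_num

/-- The value of `Φ` at the position, maximum and minimum at time `n + 1`, if the path is at `y` at
that time. -/
def stepTo (Φ : ℤ → ℤ → ℤ → ℝ) (x : ℕ → ℤ) (n : ℕ) (y : ℤ) : ℝ :=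
  Φ y (max (runMax x n) y) (min (runMin x n) y)

lemma stepTo_congr (Φ : ℤ → ℤ → ℤ → ℝ) {x y : ℕ → ℤ} {n : ℕ} (h : ∀ k ≤ n, x k = y k) (z : ℤ) :
    stepTo Φ x n z = stepTo Φ y n z := by
  simp only [stepTo, runMax_congr h, runMin_congr h]

lemma stepTo_self (Φ : ℤ → ℤ → ℤ → ℝ) (x : ℕ → ℤ) (n : ℕ) :
    stepTo Φ x n (x (n + 1)) = Φ (x (n + 1)) (runMax x (n + 1)) (runMin x (n + 1)) := by
  rw [stepTo, runMax_succ, runMin_succ]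

/-- The one-step transition operator of once-reinforced random walk. -/
noncomputable def stepMean (c : ℝ) (Φ : ℤ → ℤ → ℤ → ℝ) (x : ℕ → ℤ) (n : ℕ) : ℝ :=
  stepUpProb c x n * stepTo Φ x n (x n + 1) + (1 - stepUpProb c x n) * stepTo Φ x n (x n - 1)

lemma stepMean_congr (c : ℝ) (Φ : ℤ → ℤ → ℤ → ℝ) {x y : ℕ → ℤ} {n : ℕ} (h : ∀ k ≤ n, x k = y k) :
    stepMean c Φ x n = stepMean c Φ y n := by
  simp only [stepMean, stepUpProb_congr c h, stepTo_congr Φ h, h n le_rfl]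

lemma abs_stepMean_le {c : ℝ} (hc : 0 < c) {Φ : ℤ → ℤ → ℤ → ℝ} {B : ℝ}
    (hΦ : ∀ a b d, |Φ a b d| ≤ B) (x : ℕ → ℤ) (n : ℕ) : |stepMean c Φ x n| ≤ B := by
  obtain ⟨h0, h1⟩ := stepUpProb_mem_Icc hc x n
  have e1 := abs_le.1 (hΦ (x n + 1) (max (runMax x n) (x n + 1)) (min (runMin x n) (x n + 1)))
  have e2 := abs_le.1 (hΦ (x n - 1) (max (runMax x n) (x n - 1)) (min (runMin x n) (x n - 1)))
  simp only [stepMean, stepTo]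
  rw [abs_le]
  constructor <;> nlinarith

namespace IsOnceReinforcedRandomWalk

variable {Ω : Type*} [MeasurableSpace Ω] {P : Measure Ω} {c : ℝ} {X : ℕ → Ω → ℤ}

lemma measurable_runMax (hX : IsOnceReinforcedRandomWalk P c X) (n : ℕ) :
    Measurable fun ω => runMax (fun k => X k ω) n := by
  induction n with
  | zero => simpa [runMax] using hX.measurable 0
  | succ n ih => simpa only [runMax_succ] using ih.max (hX.measurable (n + 1))

lemma measurable_runMin (hX : IsOnceReinforcedRandomWalk P c X) (n : ℕ) :
    Measurable fun ω => runMin (fun k => X k ω) n := by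
  induction n with
  | zero => simpa [runMin] using hX.measurable 0
  | succ n ih => simpa only [runMin_succ] using ih.min (hX.measurable (n + 1))

lemma measurable_state (hX : IsOnceReinforcedRandomWalk P c X) (Φ : ℤ → ℤ → ℤ → ℝ) (n : ℕ) :
    Measurable fun ω => Φ (X n ω) (runMax (fun k => X k ω) n) (runMin (fun k => X k ω) n) := by
  have h : Measurable fun p : ℤ × ℤ × ℤ => Φ p.1 p.2.1 p.2.2 := measurable_of_countable _
  exact h.comp ((hX.measurable n).prodMk ((hX.measurable_runMax n).prodMk (hX.measurable_runMin n)))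

lemma measurable_stepUpProb (hX : IsOnceReinforcedRandomWalk P c X) (n : ℕ) :
    Measurable fun ω => stepUpProb c (fun k => X k ω) n :=
  hX.measurable_state (fun a b d => if a = b then if a = d then 1 / 2 else 1 / (1 + c)
    else if a = d then c / (1 + c) else 1 / 2) n

lemma measurable_stepMean (hX : IsOnceReinforcedRandomWalk P c X) (Φ : ℤ → ℤ → ℤ → ℝ) (n : ℕ) :
    Measurable fun ω => stepMean c Φ (fun k => X k ω) n := by
  have h1 := hX.measurable_stepUpProb n
  have h2 := hX.measurable_state (fun a b d => Φ (a + 1) (max b (a + 1)) (min d (a + 1))) n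
  have h3 := hX.measurable_state (fun a b d => Φ (a - 1) (max b (a - 1)) (min d (a - 1))) n
  exact (h1.mul h2).add ((measurable_const.sub h1).mul h3)

lemma integrable_state [IsProbabilityMeasure P] (hX : IsOnceReinforcedRandomWalk P c X)
    {Φ : ℤ → ℤ → ℤ → ℝ} {B : ℝ} (hΦ : ∀ a b d, |Φ a b d| ≤ B) (n : ℕ) :
    Integrable (fun ω => Φ (X n ω) (runMax (fun k => X k ω) n) (runMin (fun k => X k ω) n)) P :=
  Integrable.of_bound (hX.measurable_state Φ n).aestronglyMeasurable B
    (Eventually.of_forall fun _ => hΦ _ _ _)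

lemma integrable_stepMean [IsProbabilityMeasure P] (hX : IsOnceReinforcedRandomWalk P c X)
    (hc : 0 < c) {Φ : ℤ → ℤ → ℤ → ℝ} {B : ℝ} (hΦ : ∀ a b d, |Φ a b d| ≤ B) (n : ℕ) :
    Integrable (fun ω => stepMean c Φ (fun k => X k ω) n) P :=
  Integrable.of_bound (hX.measurable_stepMean Φ n).aestronglyMeasurable B
    (Eventually.of_forall fun _ => abs_stepMean_le hc hΦ _ _)

lemma measurableSet_history (hX : IsOnceReinforcedRandomWalk P c X) (n : ℕ) (x : ℕ → ℤ) :
    MeasurableSet {ω | ∀ k ≤ n, X k ω = x k} := by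
  simp only [Set.ofPred_forall]
  exact MeasurableSet.iInter fun k => MeasurableSet.iInter fun _ =>
    hX.measurable k (measurableSet_singleton _)

/-- On a fixed history the next state takes one of two values. The up and down probabilities add up
to `1`, so these two events exhaust the history up to a null set, and the integrand is constant on
each. -/
lemma setIntegral_history [IsProbabilityMeasure P] (hX : IsOnceReinforcedRandomWalk P c X)
    (hc : 0 < c) {Φ : ℤ → ℤ → ℤ → ℝ} {B : ℝ} (hΦ : ∀ a b d, |Φ a b d| ≤ B) (n : ℕ) (x : ℕ → ℤ) :
    ∫ ω in {ω | ∀ k ≤ n, X k ω = x k},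
        Φ (X (n + 1) ω) (runMax (fun k => X k ω) (n + 1)) (runMin (fun k => X k ω) (n + 1)) ∂P =
      ∫ ω in {ω | ∀ k ≤ n, X k ω = x k}, stepMean c Φ (fun k => X k ω) n ∂P := by
  set C := {ω | ∀ k ≤ n, X k ω = x k} with hC
  have hCm : MeasurableSet C := hX.measurableSet_history n x
  by_cases h0 : P C = 0
  · rw [setIntegral_measure_zero _ h0, setIntegral_measure_zero _ h0]
  set U := {ω | X (n + 1) ω = x n + 1} with hU
  set D := {ω | X (n + 1) ω = x n - 1} with hD
  have hUm : MeasurableSet U := hX.measurable (n + 1) (measurableSet_singleton _)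
  have hDm : MeasurableSet D := hX.measurable (n + 1) (measurableSet_singleton _)
  obtain ⟨hp0, hp1⟩ := stepUpProb_mem_Icc hc x n
  set p := stepUpProb c x n with hp
  have hPU : P (C ∩ U) = ENNReal.ofReal p * P C := by
    rw [← hX.step_up n x h0, cond_mul_eq_inter hCm]
  have hPD : P (C ∩ D) = ENNReal.ofReal (1 - p) * P C := by
    rw [← hX.step_down n x h0, cond_mul_eq_inter hCm]
  have hdisj : Disjoint (C ∩ U) (C ∩ D) := by
    rw [Set.disjoint_left]
    rintro ω ⟨_, h1⟩ ⟨_, h2⟩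
    simp only [hU, hD, Set.mem_ofPred_eq] at h1 h2
    omega
  have hae : ((C ∩ U) ∪ (C ∩ D) : Set Ω) =ᵐ[P] C := by
    refine ae_eq_of_subset_of_measure_ge (Set.union_subset Set.inter_subset_left
      Set.inter_subset_left) ?_ ((hCm.inter hUm).union (hCm.inter hDm)).nullMeasurableSet
      (measure_ne_top _ _)
    rw [measure_union hdisj (hCm.inter hDm), hPU, hPD, ← add_mul, ← ENNReal.ofReal_add hp0
      (by linarith)]
    simp
  have hint := hX.integrable_state hΦ (n + 1)
  have key : ∀ (V : Set Ω) (y : ℤ), MeasurableSet V → (∀ ω ∈ V, X (n + 1) ω = y) →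
      ∫ ω in C ∩ V, Φ (X (n + 1) ω) (runMax (fun k => X k ω) (n + 1))
        (runMin (fun k => X k ω) (n + 1)) ∂P = P.real (C ∩ V) * stepTo Φ x n y := by
    intro V y hV hy
    rw [← smul_eq_mul, ← setIntegral_const]
    refine setIntegral_congr_fun (hCm.inter hV) fun ω hω => ?_
    have h1 := stepTo_congr Φ (x := fun k => X k ω) (y := x) hω.1 y
    have h2 := stepTo_self Φ (fun k => X k ω) n
    rw [← hy ω hω.2] at h1 ⊢
    exact h2.symm.trans h1
  rw [← setIntegral_congr_set hae, setIntegral_union hdisj (hCm.inter hDm) hint.integrableOn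
    hint.integrableOn, key U _ hUm fun ω h => h, key D _ hDm fun ω h => h]
  have hR : ∫ ω in C, stepMean c Φ (fun k => X k ω) n ∂P = P.real C * stepMean c Φ x n := by
    rw [← smul_eq_mul, ← setIntegral_const]
    exact setIntegral_congr_fun hCm fun ω hω => stepMean_congr c Φ hω
  rw [hR, measureReal_def, measureReal_def, hPU, hPD, ENNReal.toReal_mul, ENNReal.toReal_mul,
    ENNReal.toReal_ofReal hp0, ENNReal.toReal_ofReal (by linarith), ← measureReal_def, stepMean,
    ← hp]
  ring

/-- The Markov property of position, maximum and minimum of once-reinforced random walk. -/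
lemma integral_succ [IsProbabilityMeasure P] (hX : IsOnceReinforcedRandomWalk P c X)
    (hc : 0 < c) {Φ : ℤ → ℤ → ℤ → ℝ} {B : ℝ} (hΦ : ∀ a b d, |Φ a b d| ≤ B) (n : ℕ) :
    ∫ ω, Φ (X (n + 1) ω) (runMax (fun k => X k ω) (n + 1)) (runMin (fun k => X k ω) (n + 1)) ∂P =
      ∫ ω, stepMean c Φ (fun k => X k ω) n ∂P := by
  -- Histories up to time `n` form a countable partition; extending them by `0` is harmless, since
  -- only the first `n + 1` values are used.
  let e : (Fin (n + 1) → ℤ) → ℕ → ℤ := fun x k => if h : k < n + 1 then x ⟨k, h⟩ else 0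
  have hm : ∀ x, MeasurableSet {ω | ∀ k ≤ n, X k ω = e x k} :=
    fun x => hX.measurableSet_history n _
  have hd : Pairwise (Function.onFun Disjoint fun x => {ω | ∀ k ≤ n, X k ω = e x k}) := by
    intro x y hxy
    simp only [Function.onFun]
    rw [Set.disjoint_left]
    intro ω h1 h2
    refine hxy (funext fun k => ?_)
    have hk : (k : ℕ) ≤ n := Nat.lt_succ_iff.1 k.2
    have := (h1 k hk).symm.trans (h2 k hk)
    simpa only [e, k.2, dif_pos] using this
  have hu : ⋃ x, {ω | ∀ k ≤ n, X k ω = e x k} = Set.univ := by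
    refine Set.eq_univ_of_forall fun ω => Set.mem_iUnion.2 ⟨fun k => X k ω, fun k hk => ?_⟩
    simp only [e, Nat.lt_succ_iff.2 hk, dif_pos]
  rw [← setIntegral_univ, ← setIntegral_univ (f := fun ω => stepMean c Φ (fun k => X k ω) n), ← hu,
    integral_iUnion hm hd (hX.integrable_state hΦ (n + 1)).integrableOn,
    integral_iUnion hm hd (hX.integrable_stepMean hc hΦ n).integrableOn]
  exact tsum_congr fun x => hX.setIntegral_history hc hΦ n _

end IsOnceReinforcedRandomWalk

/-! ### Generating functions of the passage times of the range -/

/-- The reciprocal of the generating function, at `1 / cosh t`, of the time that once-reinforced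
random walk needs to increase its range from `k` to `k + 1`. -/
noncomputable def waitFactor (c t : ℝ) (k : ℕ) : ℝ :=
  Real.cosh t + c * Real.sinh t * Real.tanh (t * k / 2)

/-- The generating function, at `1 / cosh t`, of the time at which the range reaches `r`. -/
noncomputable def passageGF (c t : ℝ) (r : ℕ) : ℝ := ∏ k ∈ Finset.range r, (waitFactor c t k)⁻¹

lemma tanh_nonneg_of_nonneg {x : ℝ} (hx : 0 ≤ x) : 0 ≤ Real.tanh x := by
  rw [Real.tanh_eq_sinh_div_cosh]
  exact div_nonneg (Real.sinh_nonneg_iff.2 hx) (Real.cosh_pos x).le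

lemma one_le_waitFactor {c t : ℝ} (hc : 0 < c) (ht : 0 < t) (k : ℕ) : 1 ≤ waitFactor c t k := by
  have h1 := Real.one_le_cosh t
  have h2 := Real.sinh_nonneg_iff.2 ht.le
  have h3 : 0 ≤ Real.tanh (t * k / 2) := tanh_nonneg_of_nonneg (by positivity)
  unfold waitFactor
  have : 0 ≤ c * Real.sinh t * Real.tanh (t * k / 2) := by positivity
  linarith

lemma prod_inv_waitFactor_mem {c t : ℝ} (hc : 0 < c) (ht : 0 < t) (s : Finset ℕ) :
    ∏ k ∈ s, (waitFactor c t k)⁻¹ ∈ Set.Icc (0 : ℝ) 1 :=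
  ⟨Finset.prod_nonneg fun k _ => inv_nonneg.2 (zero_le_one.trans (one_le_waitFactor hc ht k)),
    Finset.prod_le_one (fun k _ => inv_nonneg.2 (zero_le_one.trans (one_le_waitFactor hc ht k)))
      fun k _ => inv_le_one_of_one_le₀ (one_le_waitFactor hc ht k)⟩

/-- The generating function, at `1 / cosh t`, of the time until the range reaches `r`, for the walk
started at `a` with maximum `b` and minimum `d`. -/
noncomputable def passagePotential (c t : ℝ) (r : ℕ) (a b d : ℤ) : ℝ :=
  if d ≤ a ∧ a ≤ b then
    if (r : ℤ) ≤ b - d then 1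
    else Real.cosh (t * (a - (b + d) / 2)) / Real.cosh (t * (b - d) / 2) *
      ∏ k ∈ Finset.Ico (b - d).toNat r, (waitFactor c t k)⁻¹
  else 0

lemma passagePotential_mem {c t : ℝ} (hc : 0 < c) (ht : 0 < t) (r : ℕ) (a b d : ℤ) :
    passagePotential c t r a b d ∈ Set.Icc (0 : ℝ) 1 := by
  unfold passagePotential
  split_ifs with h1 h2
  · simp
  · obtain ⟨g0, g1⟩ := prod_inv_waitFactor_mem hc ht (Finset.Ico (b - d).toNat r)
    have h3 : (d : ℝ) ≤ a := by exact_mod_cast h1.1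
    have h4 : (a : ℝ) ≤ b := by exact_mod_cast h1.2
    have h5 : Real.cosh (t * (a - (b + d) / 2)) ≤ Real.cosh (t * (b - d) / 2) := by
      rw [Real.cosh_le_cosh, mul_div_assoc, abs_mul, abs_mul, abs_of_pos ht]
      refine mul_le_mul_of_nonneg_left ?_ ht.le
      rw [abs_of_nonneg (a := ((b : ℝ) - d) / 2) (by linarith), abs_le]
      constructor <;> linarith
    have h6 := Real.cosh_pos (t * (a - (b + d) / 2))
    have h7 := Real.cosh_pos (t * (b - d) / 2)
    refine ⟨by positivity, mul_le_one₀ ((div_le_one h7).2 h5) g0 g1⟩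
  · simp

lemma passagePotential_of_le {c t : ℝ} {r : ℕ} {a b d : ℤ} (h : d ≤ a ∧ a ≤ b)
    (hr : (r : ℤ) ≤ b - d) : passagePotential c t r a b d = 1 := by
  rw [passagePotential, if_pos h, if_pos hr]

lemma passagePotential_of_lt {c t : ℝ} {r N : ℕ} {a b d : ℤ} (h : d ≤ a ∧ a ≤ b)
    (hr : N < r) (hN : b - d = N) : passagePotential c t r a b d =
      Real.cosh (t * (a - (b + d) / 2)) / Real.cosh (t * N / 2) *
      ∏ k ∈ Finset.Ico N r, (waitFactor c t k)⁻¹ := by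
  have e : (b : ℝ) - d = N := by exact_mod_cast hN
  rw [passagePotential, if_pos h, if_neg (by omega), e]
  simp [hN]

lemma passagePotential_of_extreme {c t : ℝ} {r N : ℕ} {a b d : ℤ} (h : d ≤ a ∧ a ≤ b)
    (hN : b - d = N) (ha : a = b ∨ a = d) : passagePotential c t r a b d =
      ∏ k ∈ Finset.Ico N r, (waitFactor c t k)⁻¹ := by
  rcases lt_or_ge N r with hr | hr
  · have e : (b : ℝ) - d = N := by exact_mod_cast hN
    rw [passagePotential_of_lt h hr hN]
    have : Real.cosh (t * (a - (b + d) / 2)) = Real.cosh (t * N / 2) := by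
      rcases ha with ha | ha
      · rw [ha, ← e]; congr 1; ring
      · rw [ha, ← e, ← Real.cosh_neg]; congr 1; ring
    rw [this, div_self (Real.cosh_pos _).ne', one_mul]
  · rw [passagePotential_of_le h (by omega), Finset.Ico_eq_empty (by omega), Finset.prod_empty]

lemma cosh_sub_div_cosh (y t : ℝ) :
    Real.cosh (y - t) / Real.cosh y = Real.cosh t - Real.sinh t * Real.tanh y := by
  have := (Real.cosh_pos y).ne'
  rw [Real.cosh_sub, Real.tanh_eq_sinh_div_cosh]
  field_simp

/-- Before the range reaches `r`, the potential is an eigenfunction with eigenvalue `cosh t`;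
afterwards it is frozen at `1`, which the second summand corrects for. Inside the interval this is
the addition formula for `cosh`. At an endpoint with range `N` it reads `(1 + c) cosh t = w + c
(cosh t - sinh t tanh (t N / 2))`, and solving for `w` gives `waitFactor`. -/
lemma stepMean_passagePotential {c t : ℝ} (hc : 0 < c) (ht : 0 < t) (r : ℕ) (x : ℕ → ℤ) (n : ℕ) :
    stepMean c (passagePotential c t r) x n =
      Real.cosh t * passagePotential c t r (x n) (runMax x n) (runMin x n) +
        (1 - Real.cosh t) * if (r : ℤ) ≤ runMax x n - runMin x n then 1 else 0 := by
  have hM := le_runMax x n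
  have hm := runMin_le x n
  unfold stepMean stepTo stepUpProb
  set b := runMax x n
  set d := runMin x n
  set a := x n
  by_cases hr : (r : ℤ) ≤ b - d
  · rw [passagePotential_of_le ⟨by omega, by omega⟩ (by omega),
      passagePotential_of_le ⟨by omega, by omega⟩ (by omega),
      passagePotential_of_le ⟨by omega, by omega⟩ hr, if_pos hr]
    ring
  obtain ⟨N, hN⟩ : ∃ N : ℕ, b - d = N := ⟨(b - d).toNat, by omega⟩
  have hNr : N < r := by omega
  have e : (b : ℝ) - d = N := by exact_mod_cast hN
  have hprod := Finset.prod_eq_prod_Ico_succ_bot hNr fun k => (waitFactor c t k)⁻¹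
  have hF : waitFactor c t N ≠ 0 := (zero_lt_one.trans_le (one_le_waitFactor hc ht N)).ne'
  have hc1 : 1 + c ≠ 0 := by positivity
  rw [if_neg hr, mul_zero, add_zero]
  -- A step that enlarges the range drops the factor of index `N`, that is, multiplies the potential
  -- by `waitFactor c t N`.
  have hprod' : ∏ k ∈ Finset.Ico (N + 1) r, (waitFactor c t k)⁻¹ =
      waitFactor c t N * ∏ k ∈ Finset.Ico N r, (waitFactor c t k)⁻¹ := by
    rw [hprod]; field_simp
  by_cases hab : a = b
  · rw [if_pos hab, max_eq_right (by omega : b ≤ a + 1), min_eq_left (by omega : d ≤ a + 1),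
      passagePotential_of_extreme (N := N + 1) ⟨by omega, by omega⟩ (by push_cast; omega) (Or.inl rfl),
      max_eq_left (by omega : a - 1 ≤ b), passagePotential_of_extreme (a := a) (N := N)
      ⟨by omega, by omega⟩ hN (Or.inl hab), hprod']
    -- When the interval is a single point, both steps enlarge the range, and the factor is just
    -- `cosh t` because `tanh 0 = 0`.
    by_cases had : a = d
    · have hN0 : N = 0 := by omega
      rw [if_pos had, min_eq_right (by omega : a - 1 ≤ d), passagePotential_of_extreme (N := N + 1)
        ⟨by omega, by omega⟩ (by push_cast; omega) (Or.inr rfl), hprod']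
      have hw : waitFactor c t N = Real.cosh t := by simp [waitFactor, hN0]
      rw [hw]
      ring
    · rw [if_neg had, min_eq_left (by omega : d ≤ a - 1), passagePotential_of_lt
        ⟨by omega, by omega⟩ hNr hN]
      have : t * (((a - 1 : ℤ) : ℝ) - (b + d) / 2) = t * N / 2 - t := by
        rw [← e, hab]; push_cast; ring
      rw [this, cosh_sub_div_cosh, waitFactor]
      field_simp
      ring
  · rw [if_neg hab, max_eq_left (by omega : a - 1 ≤ b), max_eq_left (by omega : a + 1 ≤ b),
      min_eq_left (by omega : d ≤ a + 1), passagePotential_of_lt (a := a + 1)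
        ⟨by omega, by omega⟩ hNr hN]
    by_cases had : a = d
    · rw [if_pos had, min_eq_right (by omega : a - 1 ≤ d), passagePotential_of_extreme (N := N + 1)
        ⟨by omega, by omega⟩ (by push_cast; omega) (Or.inr rfl), hprod',
        passagePotential_of_extreme (a := a) (N := N) ⟨by omega, by omega⟩ hN (Or.inr had)]
      have : t * (((a + 1 : ℤ) : ℝ) - (b + d) / 2) = -(t * N / 2 - t) := by
        rw [← e, had]; push_cast; ring
      rw [this, Real.cosh_neg, cosh_sub_div_cosh, waitFactor]
      field_simp
      ring
    · rw [if_neg had, min_eq_left (by omega : d ≤ a - 1), passagePotential_of_lt (a := a - 1)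
        ⟨by omega, by omega⟩ hNr hN, passagePotential_of_lt (a := a) ⟨by omega, by omega⟩ hNr hN]
      have e1 : t * (((a + 1 : ℤ) : ℝ) - (b + d) / 2) = t * (a - (b + d) / 2) + t := by
        push_cast; ring
      have e2 : t * (((a - 1 : ℤ) : ℝ) - (b + d) / 2) = t * (a - (b + d) / 2) - t := by
        push_cast; ring
      rw [e1, e2, Real.cosh_add, Real.cosh_sub]
      ring

namespace IsOnceReinforcedRandomWalk

variable {Ω : Type*} [MeasurableSpace Ω] {P : Measure Ω} {c : ℝ} {X : ℕ → Ω → ℤ}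

lemma measurable_pathRange (hX : IsOnceReinforcedRandomWalk P c X) (n : ℕ) :
    Measurable fun ω => pathRange (fun k => X k ω) n :=
  (hX.measurable_runMax n).sub (hX.measurable_runMin n)

lemma integral_ite_pathRange (hX : IsOnceReinforcedRandomWalk P c X) (r n : ℕ) :
    ∫ ω, (if (r : ℤ) ≤ runMax (fun k => X k ω) n - runMin (fun k => X k ω) n then (1 : ℝ) else 0) ∂P
      = P.real {ω | (r : ℤ) ≤ pathRange (fun k => X k ω) n} := by
  rw [← integral_indicator_one (measurableSet_le measurable_const (hX.measurable_pathRange n))]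
  refine integral_congr_ae (Eventually.of_forall fun ω => ?_)
  simp [Set.indicator_apply, pathRange]

/-- The generating function of the distribution functions of the times at which the range of
once-reinforced random walk reaches `r`. -/
lemma hasSum_pow_mul_tail [IsProbabilityMeasure P] (hX : IsOnceReinforcedRandomWalk P c X)
    (hc : 0 < c) {t : ℝ} (ht : 0 < t) (r : ℕ) :
    HasSum (fun n : ℕ => (Real.cosh t)⁻¹ ^ n * P.real {ω | (r : ℤ) ≤ pathRange (fun k => X k ω) n})
      (passageGF c t r / (1 - (Real.cosh t)⁻¹)) := by
  set s := (Real.cosh t)⁻¹ with hs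
  have hcosh : 1 < Real.cosh t := Real.one_lt_cosh.2 ht.ne'
  have hs0 : 0 < s := by positivity
  have hs1 : s < 1 := inv_lt_one_of_one_lt₀ hcosh
  set p : ℕ → ℝ := fun n => P.real {ω | (r : ℤ) ≤ pathRange (fun k => X k ω) n} with hp
  have hΦ : ∀ a b d, |passagePotential c t r a b d| ≤ 1 := fun a b d => by
    obtain ⟨h0, h1⟩ := passagePotential_mem hc ht r a b d
    rwa [abs_of_nonneg h0]
  set A : ℕ → ℝ := fun n => ∫ ω, passagePotential c t r (X n ω) (runMax (fun k => X k ω) n)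
    (runMin (fun k => X k ω) n) ∂P with hA
  have hrec : ∀ n, A (n + 1) = Real.cosh t * A n + (1 - Real.cosh t) * p n := by
    intro n
    simp only [hA, hp]
    rw [hX.integral_succ hc hΦ n, ← hX.integral_ite_pathRange, ← integral_const_mul,
      ← integral_const_mul, ← integral_add]
    · exact integral_congr_ae (Eventually.of_forall fun ω => stepMean_passagePotential hc ht r _ n)
    · exact (hX.integrable_state hΦ n).const_mul _
    · exact (hX.integrable_state (Φ := fun _ b d => if (r : ℤ) ≤ b - d then 1 else 0) (B := 1)
        (fun a b d => by split_ifs <;> simp) n).const_mul _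
  have hA01 : ∀ n, |A n| ≤ 1 := fun n => by
    have := norm_integral_le_of_norm_le_const (μ := P) (C := 1)
      (f := fun ω => passagePotential c t r (X n ω) (runMax (fun k => X k ω) n)
        (runMin (fun k => X k ω) n)) (Eventually.of_forall fun ω => hΦ _ _ _)
    simpa using this
  have hA0 : A 0 = passageGF c t r := by
    have : ∀ᵐ ω ∂P, passagePotential c t r (X 0 ω) (runMax (fun k => X k ω) 0)
        (runMin (fun k => X k ω) 0) = passageGF c t r := by
      filter_upwards [hX.start] with ω hω
      rw [passagePotential_of_extreme (N := 0)] <;> simp [runMax, runMin, hω, passageGF]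
    simp only [hA]
    rw [integral_congr_ae this]
    simp
  -- Multiplied by `s^(n+1)`, the recursion becomes `s^n A n - s^(n+1) A (n+1) = (1 - s) s^n p n`,
  -- which telescopes.
  have hsum : ∀ n, ∑ k ∈ Finset.range n, s ^ k * p k = (A 0 - s ^ n * A n) / (1 - s) := by
    intro n
    have h1s : 1 - s ≠ 0 := by linarith
    induction n with
    | zero => simp
    | succ n ih =>
      rw [Finset.sum_range_succ, ih, hrec, pow_succ]
      have : s * Real.cosh t = 1 := inv_mul_cancel₀ (by positivity)
      field_simp
      linear_combination s ^ n * (A n - p n) * this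
  rw [hasSum_iff_tendsto_nat_of_nonneg fun n => by positivity]
  have hlim : Tendsto (fun n => s ^ n * A n) atTop (𝓝 0) := by
    refine squeeze_zero_norm (fun n => ?_) (tendsto_pow_atTop_nhds_zero_of_lt_one hs0.le hs1)
    rw [norm_mul, norm_pow, Real.norm_of_nonneg hs0.le]
    exact mul_le_of_le_one_right (by positivity) (hA01 n)
  have := (hlim.const_sub (A 0)).div_const (1 - s)
  rw [sub_zero, hA0] at this
  refine this.congr fun n => ?_
  rw [hsum, hA0]

end IsOnceReinforcedRandomWalk

/-! ### Decay and pointwise limit of the generating functions -/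

lemma tanh_le_tanh {x y : ℝ} (hxy : x ≤ y) : Real.tanh x ≤ Real.tanh y := by
  rw [Real.tanh_eq_sinh_div_cosh, Real.tanh_eq_sinh_div_cosh, div_le_div_iff₀ (Real.cosh_pos x)
    (Real.cosh_pos y)]
  have : 0 ≤ Real.sinh (y - x) := Real.sinh_nonneg_iff.2 (by linarith)
  rw [Real.sinh_sub] at this
  linarith

lemma tanh_pos_of_pos {x : ℝ} (hx : 0 < x) : 0 < Real.tanh x := by
  rw [Real.tanh_eq_sinh_div_cosh]
  exact div_pos (Real.sinh_pos_iff.2 hx) (Real.cosh_pos x)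

/-- The exponential rate with which the generating functions of the passage times decay. -/
noncomputable def decayRate (c : ℝ) : ℝ := min c 1 * Real.tanh (1 / 2)

lemma decayRate_pos {c : ℝ} (hc : 0 < c) : 0 < decayRate c :=
  mul_pos (lt_min hc one_pos) (tanh_pos_of_pos (by norm_num))

/-- Convexity of `exp` gives `exp (a t) ≤ cosh t + a sinh t` for `|a| ≤ 1`; capping `c` at `1` in
`decayRate` makes this applicable. -/
lemma exp_decayRate_le_waitFactor {c t : ℝ} (hc : 0 < c) (ht : 0 < t) {k : ℕ} (hk : 1 ≤ t * k) :
    Real.exp (decayRate c * t) ≤ waitFactor c t k := by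
  have h0 : 0 ≤ Real.tanh (t * k / 2) := tanh_nonneg_of_nonneg (by positivity)
  have h1 := (Real.tanh_lt_one (t * k / 2)).le
  have h2 : Real.tanh (1 / 2) ≤ Real.tanh (t * k / 2) :=
    tanh_le_tanh (by linarith)
  have hm0 : 0 < min c 1 := lt_min hc one_pos
  have hs := Real.sinh_nonneg_iff.2 ht.le
  have h3 : |min c 1 * Real.tanh (t * k / 2)| ≤ 1 := by
    rw [abs_of_nonneg (by positivity)]
    exact mul_le_one₀ (min_le_right _ _) h0 h1
  calc Real.exp (decayRate c * t) ≤ Real.exp (min c 1 * Real.tanh (t * k / 2) * t) := by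
        unfold decayRate; gcongr
    _ ≤ Real.cosh t + min c 1 * Real.tanh (t * k / 2) * Real.sinh t :=
        Real.exp_mul_le_cosh_add_mul_sinh h3 t
    _ ≤ Real.cosh t + c * Real.tanh (t * k / 2) * Real.sinh t := by
        gcongr; exact min_le_left _ _
    _ = waitFactor c t k := by unfold waitFactor; ring

lemma passageGF_succ (c t : ℝ) (r : ℕ) :
    passageGF c t (r + 1) = passageGF c t r * (waitFactor c t r)⁻¹ :=
  Finset.prod_range_succ _ _

lemma passageGF_nonneg {c t : ℝ} (hc : 0 < c) (ht : 0 < t) (r : ℕ) : 0 ≤ passageGF c t r :=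
  (prod_inv_waitFactor_mem hc ht _).1

lemma passageGF_le_one {c t : ℝ} (hc : 0 < c) (ht : 0 < t) (r : ℕ) : passageGF c t r ≤ 1 :=
  (prod_inv_waitFactor_mem hc ht _).2

/-- This supplies the dominating function for the limit `t → 0`. The factors with `t k < 1` are only
known to be at most `1`; the prefactor `exp (decayRate c * (1 + t))` pays for them. -/
lemma passageGF_le {c t : ℝ} (hc : 0 < c) (ht : 0 < t) (r : ℕ) :
    passageGF c t r ≤ Real.exp (decayRate c * (1 + t)) * Real.exp (-(decayRate c * (t * r))) := by
  have hl := decayRate_pos hc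
  induction r with
  | zero =>
    refine (passageGF_le_one hc ht 0).trans ?_
    rw [← Real.exp_add, Real.one_le_exp_iff]
    simp; positivity
  | succ r ih =>
    rcases le_or_gt 1 (t * r) with h | h
    · rw [passageGF_succ]
      have h2 : (waitFactor c t r)⁻¹ ≤ Real.exp (-(decayRate c * t)) := by
        rw [Real.exp_neg]
        exact inv_anti₀ (Real.exp_pos _) (exp_decayRate_le_waitFactor hc ht h)
      refine (mul_le_mul ih h2 (inv_nonneg.2 (zero_le_one.trans (one_le_waitFactor hc ht r)))
        (by positivity)).trans_eq ?_
      rw [← Real.exp_add, ← Real.exp_add, ← Real.exp_add]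
      congr 1
      push_cast
      ring
    · refine (passageGF_le_one hc ht _).trans ?_
      rw [← Real.exp_add, Real.one_le_exp_iff]
      push_cast
      have : 0 ≤ decayRate c * (1 - t * r) := mul_nonneg hl.le (by linarith)
      linarith

/-- Write the argument as `1 + y`. Second-order bounds on `cosh` and `sinh` put `y` within `(1 + c)
t²` of `c τ t`, and `y - y² ≤ log (1 + y) ≤ y` with `y ≤ (1 + 2c) t` gives the rest. -/
lemma abs_log_cosh_add_sub_le {c t τ : ℝ} (hc : 0 < c) (ht : 0 < t) (ht1 : t ≤ 1) (h0 : 0 ≤ τ)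
    (h1 : τ ≤ 1) : |Real.log (Real.cosh t + c * Real.sinh t * τ) - c * τ * t| ≤
      ((1 + c) + (1 + 2 * c) ^ 2) * t ^ 2 := by
  have e1 := abs_le.1 (Real.abs_exp_sub_one_sub_id_le (x := t) (by rw [abs_of_pos ht]; exact ht1))
  have e2 := abs_le.1 (Real.abs_exp_sub_one_sub_id_le (x := -t)
    (by rw [abs_neg, abs_of_pos ht]; exact ht1))
  have hch := Real.one_le_cosh t
  have hsh := Real.sinh_nonneg_iff.2 ht.le
  have hc1 : Real.cosh t ≤ 1 + t ^ 2 := by rw [Real.cosh_eq]; linarith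
  have hs1 : |Real.sinh t - t| ≤ t ^ 2 := by
    rw [Real.sinh_eq, abs_le]; constructor <;> linarith
  rw [abs_le] at hs1
  have ht2 : t ^ 2 ≤ t := by nlinarith
  set y := Real.cosh t - 1 + c * Real.sinh t * τ with hy
  have hy0 : 0 ≤ y := by
    have : 0 ≤ c * Real.sinh t * τ := by positivity
    linarith
  have hcτ : 0 ≤ c * τ := by positivity
  have hcτ' : c * τ ≤ c := mul_le_of_le_one_right hc.le h1
  have hmain : |y - c * τ * t| ≤ (1 + c) * t ^ 2 := by
    have : y - c * τ * t = (Real.cosh t - 1) + c * τ * (Real.sinh t - t) := by rw [hy]; ring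
    rw [this, abs_le]
    have a1 : c * τ * (Real.sinh t - t) ≤ c * t ^ 2 :=
      (mul_le_mul_of_nonneg_left hs1.2 hcτ).trans (mul_le_mul_of_nonneg_right hcτ' (by positivity))
    have a2 : -(c * t ^ 2) ≤ c * τ * (Real.sinh t - t) := by
      have := mul_le_mul_of_nonneg_left hs1.1 hcτ
      have := mul_le_mul_of_nonneg_right hcτ' (sq_nonneg t)
      linarith
    constructor <;> nlinarith
  rw [abs_le] at hmain
  have hyt : y ≤ (1 + 2 * c) * t := by
    have : c * τ * t ≤ c * t := mul_le_mul_of_nonneg_right hcτ' ht.le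
    nlinarith
  have hy2 : y ^ 2 ≤ (1 + 2 * c) ^ 2 * t ^ 2 := by
    rw [← mul_pow]; exact pow_le_pow_left₀ hy0 hyt 2
  have harg : Real.cosh t + c * Real.sinh t * τ = 1 + y := by rw [hy]; ring
  have hlog1 : Real.log (1 + y) ≤ y := by
    have := Real.log_le_sub_one_of_pos (x := 1 + y) (by linarith); linarith
  have hlog2 : y - y ^ 2 ≤ Real.log (1 + y) := by
    refine le_trans ?_ (Real.one_sub_inv_le_log_of_pos (x := 1 + y) (by linarith))
    have : 1 - (1 + y)⁻¹ = y / (1 + y) := by field_simp; ring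
    rw [this, le_div_iff₀ (by linarith)]
    nlinarith [pow_nonneg hy0 3]
  rw [harg, abs_le]
  constructor <;> nlinarith

/-- The quadratic error constant in the comparison of the passage time generating functions with
their continuum limit. -/
noncomputable def errorConst (c : ℝ) : ℝ := (1 + c) + (1 + 2 * c) ^ 2 + 22 * c

/-- The increments of `log cosh (t k / 2)` have the same form as `log (waitFactor c t k)`, with `1`
and `t / 2` in place of `c` and `t`. One estimate thus handles both the product and its continuum
limit. -/
lemma log_cosh_succ (t : ℝ) (k : ℕ) :
    Real.log (Real.cosh (t / 2) + 1 * Real.sinh (t / 2) * Real.tanh (t * k / 2)) =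
      Real.log (Real.cosh (t * (k + 1 : ℕ) / 2)) - Real.log (Real.cosh (t * k / 2)) := by
  have h := (Real.cosh_pos (t * k / 2)).ne'
  rw [← Real.log_div (Real.cosh_pos _).ne' h]
  congr 1
  rw [show t * (k + 1 : ℕ) / 2 = t * k / 2 + t / 2 by push_cast; ring, Real.cosh_add,
    Real.tanh_eq_sinh_div_cosh]
  field_simp

lemma abs_log_passageGF_add_le {c t : ℝ} (hc : 0 < c) (ht : 0 < t) (ht1 : t ≤ 1) (r : ℕ) :
    |Real.log (passageGF c t r) + 2 * c * Real.log (Real.cosh (t * r / 2))| ≤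
      errorConst c * (r * t ^ 2) := by
  induction r with
  | zero => simp [passageGF]
  | succ r ih =>
    have hw := one_le_waitFactor hc ht r
    have hG : passageGF c t r ≠ 0 := Finset.prod_ne_zero_iff.2 fun k _ =>
      inv_ne_zero (zero_lt_one.trans_le (one_le_waitFactor hc ht k)).ne'
    have hτ0 : 0 ≤ Real.tanh (t * r / 2) := tanh_nonneg_of_nonneg (by positivity)
    have hτ1 := (Real.tanh_lt_one (t * r / 2)).le
    have b1 := abs_le.1 (abs_log_cosh_add_sub_le hc ht ht1 hτ0 hτ1)
    have b2 := abs_le.1 (abs_log_cosh_add_sub_le one_pos (half_pos ht) (by linarith) hτ0 hτ1)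
    rw [log_cosh_succ] at b2
    rw [passageGF_succ, Real.log_mul hG (by positivity), Real.log_inv]
    change _ ≤ Real.log (waitFactor c t r) - _ ∧ Real.log (waitFactor c t r) - _ ≤ _ at b1
    set w := Real.log (waitFactor c t r)
    set l1 := Real.log (Real.cosh (t * (r + 1 : ℕ) / 2))
    set l0 := Real.log (Real.cosh (t * r / 2))
    set τ := Real.tanh (t * r / 2)
    -- Doubled and multiplied by `c`, the main term `τ t / 2` cancels `c τ t`. The error this adds
    -- is `2c · 11 (t/2)²`, well below the `22 c t²` allotted in `errorConst`.
    have b3 := mul_le_mul_of_nonneg_left b2.1 (by positivity : 0 ≤ 2 * c)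
    have b4 := mul_le_mul_of_nonneg_left b2.2 (by positivity : 0 ≤ 2 * c)
    have hct : 0 ≤ c * t ^ 2 := by positivity
    rw [abs_le] at ih ⊢
    unfold errorConst at ih ⊢
    push_cast
    constructor <;> nlinarith

lemma tendsto_mul_floor_div_add_one (x : ℝ) (hx : 0 ≤ x) :
    Tendsto (fun t : ℝ => t * ((⌊x / t⌋₊ + 1 : ℕ) : ℝ)) (𝓝[>] 0) (𝓝 x) := by
  have h1 : Tendsto (fun t : ℝ => x + t) (𝓝[>] 0) (𝓝 x) := by
    have : Tendsto (fun t : ℝ => x + t) (𝓝 0) (𝓝 (x + 0)) := tendsto_id.const_add x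
    rw [add_zero] at this
    exact this.mono_left nhdsWithin_le_nhds
  refine tendsto_of_tendsto_of_tendsto_of_le_of_le' tendsto_const_nhds h1 ?_ ?_
  · filter_upwards [self_mem_nhdsWithin] with t ht
    have ht' : (0 : ℝ) < t := ht
    have := (Nat.lt_floor_add_one (x / t)).le
    rw [div_le_iff₀ ht'] at this
    push_cast
    linarith
  · filter_upwards [self_mem_nhdsWithin] with t ht
    have ht' : (0 : ℝ) < t := ht
    have := Nat.floor_le (a := x / t) (by positivity)
    rw [le_div_iff₀ ht'] at this
    push_cast
    linarith

lemma tendsto_passageGF {c : ℝ} (hc : 0 < c) {x : ℝ} (hx : 0 ≤ x) :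
    Tendsto (fun t : ℝ => passageGF c t (⌊x / t⌋₊ + 1)) (𝓝[>] 0)
      (𝓝 (Real.exp (-(2 * c * Real.log (Real.cosh (x / 2)))))) := by
  have hr := tendsto_mul_floor_div_add_one x hx
  have ht0 : Tendsto (fun t : ℝ => t) (𝓝[>] 0) (𝓝 0) := nhdsWithin_le_nhds
  have hcont : Continuous fun y : ℝ => 2 * c * Real.log (Real.cosh (y / 2)) :=
    continuous_const.mul ((Real.continuous_cosh.comp (continuous_id.div_const 2)).log
      fun y => (Real.cosh_pos _).ne')
  have h1 := (hcont.tendsto x).comp hr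
  -- With `r ≈ x / t`, the accumulated error `r t²` is about `x t`.
  have h2 : Tendsto (fun t : ℝ => errorConst c * (((⌊x / t⌋₊ + 1 : ℕ) : ℝ) * t ^ 2)) (𝓝[>] 0)
      (𝓝 0) := by
    have := (hr.mul ht0).const_mul (errorConst c)
    rw [mul_zero, mul_zero] at this
    refine this.congr fun t => ?_
    ring
  have h3 : Tendsto (fun t : ℝ => Real.log (passageGF c t (⌊x / t⌋₊ + 1)) +
      2 * c * Real.log (Real.cosh (t * ((⌊x / t⌋₊ + 1 : ℕ) : ℝ) / 2))) (𝓝[>] 0) (𝓝 0) := by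
    refine squeeze_zero_norm' ?_ h2
    filter_upwards [Ioc_mem_nhdsGT (zero_lt_one (α := ℝ))] with t ht
    exact abs_log_passageGF_add_le hc ht.1 ht.2 _
  have h4 := (Real.continuous_exp.tendsto _).comp (h3.sub h1)
  rw [zero_sub] at h4
  refine h4.congr' ?_
  filter_upwards [self_mem_nhdsWithin] with t ht
  have hG : 0 < passageGF c t (⌊x / t⌋₊ + 1) := Finset.prod_pos fun k _ =>
    inv_pos.2 (zero_lt_one.trans_le (one_le_waitFactor hc ht k))
  simp only [Function.comp, add_sub_cancel_right, Real.exp_log hG]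

/-! ### Sums over the range as integrals, and their limit -/

/-- The integrand whose integral is the Riemann-Stieltjes sum of the passage time generating
functions. -/
noncomputable def passageIntegrand (c : ℝ) (m : ℕ) (t x : ℝ) : ℝ :=
  (m + 1) * x ^ m * passageGF c t (⌊x / t⌋₊ + 1)

lemma measurable_passageIntegrand (c : ℝ) (m : ℕ) (t : ℝ) :
    Measurable (passageIntegrand c m t) := by
  have h : Measurable fun k : ℕ => passageGF c t (k + 1) := measurable_of_countable _
  have h2 : Measurable fun x : ℝ => passageGF c t (⌊x / t⌋₊ + 1) :=
    h.comp (Nat.measurable_floor.comp (measurable_id.div_const t))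
  exact (measurable_const.mul (measurable_id.pow_const m)).mul h2

lemma norm_passageIntegrand_le {c t : ℝ} (hc : 0 < c) (ht : 0 < t) (m : ℕ) {x : ℝ} (hx : 0 ≤ x) :
    ‖passageIntegrand c m t x‖ ≤ (m + 1) * x ^ m *
      (Real.exp (decayRate c * (1 + t)) * Real.exp (-(decayRate c * x))) := by
  have hG := passageGF_nonneg hc ht (⌊x / t⌋₊ + 1)
  rw [Real.norm_of_nonneg (by unfold passageIntegrand; positivity), passageIntegrand]
  refine mul_le_mul_of_nonneg_left ((passageGF_le hc ht _).trans ?_) (by positivity)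
  refine mul_le_mul_of_nonneg_left ?_ (Real.exp_pos _).le
  rw [Real.exp_le_exp, neg_le_neg_iff]
  refine mul_le_mul_of_nonneg_left ?_ (decayRate_pos hc).le
  have := (Nat.lt_floor_add_one (x / t)).le
  rw [div_le_iff₀ ht] at this
  push_cast
  linarith

lemma integrableOn_passageBound {c : ℝ} (hc : 0 < c) (m : ℕ) (B : ℝ) :
    IntegrableOn (fun x : ℝ => (m + 1) * x ^ m * (B * Real.exp (-(decayRate c * x))))
      (Set.Ioi 0) := by
  have h := integrableOn_rpow_mul_exp_neg_mul_rpow (s := (m : ℝ)) (p := 1)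
    (by have : (0 : ℝ) ≤ m := by positivity
        linarith) one_pos (decayRate_pos hc)
  refine IntegrableOn.congr_fun (h.const_mul ((m + 1) * B)) (fun x _ => ?_) measurableSet_Ioi
  simp only [Real.rpow_natCast, Real.rpow_one]
  rw [neg_mul]
  ring

lemma integrableOn_passageIntegrand {c t : ℝ} (hc : 0 < c) (ht : 0 < t) (m : ℕ) :
    IntegrableOn (passageIntegrand c m t) (Set.Ioi 0) := by
  refine Integrable.mono' (integrableOn_passageBound hc m (Real.exp (decayRate c * (1 + t))))
    (measurable_passageIntegrand c m t).aestronglyMeasurable ?_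
  filter_upwards [ae_restrict_mem measurableSet_Ioi] with x hx
  exact norm_passageIntegrand_le hc ht m (le_of_lt hx)

/-- An exact identity: on the cell `[j t, (j+1) t)` the generating function is constant, and `(m+1)
x^m` integrates to `t^(m+1) ((j+1)^(m+1) - j^(m+1))`. -/
lemma hasSum_passageGF {c t : ℝ} (hc : 0 < c) (ht : 0 < t) (m : ℕ) :
    HasSum (fun j : ℕ => t ^ (m + 1) * ((((j : ℝ) + 1) ^ (m + 1) - (j : ℝ) ^ (m + 1)) *
      passageGF c t (j + 1))) (∫ x in Set.Ioi (0 : ℝ), passageIntegrand c m t x) := by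
  have hmem : ∀ (j : ℕ) (x : ℝ), x ∈ Set.Ico (j * t) ((j + 1) * t) ↔ 0 ≤ x ∧ ⌊x / t⌋₊ = j := by
    intro j x
    constructor
    · intro h
      have hx : 0 ≤ x := le_trans (by positivity) h.1
      refine ⟨hx, (Nat.floor_eq_iff (by positivity)).2 ⟨?_, ?_⟩⟩
      · rw [le_div_iff₀ ht]; exact h.1
      · rw [div_lt_iff₀ ht]; exact h.2
    · rintro ⟨hx, h⟩
      obtain ⟨h1, h2⟩ := (Nat.floor_eq_iff (by positivity)).1 h
      rw [le_div_iff₀ ht] at h1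
      rw [div_lt_iff₀ ht] at h2
      exact ⟨h1, h2⟩
  have hu : ⋃ j : ℕ, Set.Ico ((j : ℝ) * t) ((j + 1) * t) = Set.Ici 0 := by
    ext x
    simp only [Set.mem_iUnion, hmem, Set.mem_Ici]
    exact ⟨fun ⟨_, h, _⟩ => h, fun h => ⟨_, h, rfl⟩⟩
  have hd : Pairwise (Function.onFun Disjoint fun j : ℕ => Set.Ico ((j : ℝ) * t) ((j + 1) * t)) := by
    intro i j hij
    simp only [Function.onFun]
    rw [Set.disjoint_left]
    intro x hi hj
    exact hij (((hmem i x).1 hi).2.symm.trans ((hmem j x).1 hj).2)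
  have hI : IntegrableOn (passageIntegrand c m t) (⋃ j : ℕ, Set.Ico ((j : ℝ) * t) ((j + 1) * t)) := by
    rw [hu, integrableOn_Ici_iff_integrableOn_Ioi]
    exact integrableOn_passageIntegrand hc ht m
  have := hasSum_integral_iUnion (fun j => measurableSet_Ico) hd hI
  rw [hu, integral_Ici_eq_integral_Ioi] at this
  have e : ∀ j : ℕ, ∫ x in Set.Ico ((j : ℝ) * t) ((j + 1) * t), passageIntegrand c m t x =
      t ^ (m + 1) * ((((j : ℝ) + 1) ^ (m + 1) - (j : ℝ) ^ (m + 1)) * passageGF c t (j + 1)) := by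
    intro j
    have e1 : ∫ x in Set.Ico ((j : ℝ) * t) ((j + 1) * t), passageIntegrand c m t x =
        ∫ x in Set.Ico ((j : ℝ) * t) ((j + 1) * t), (m + 1) * passageGF c t (j + 1) * x ^ m := by
      refine setIntegral_congr_fun measurableSet_Ico fun x hx => ?_
      simp only [passageIntegrand, ((hmem j x).1 hx).2]
      ring
    have hm : (m + 1 : ℝ) ≠ 0 := by positivity
    rw [e1, integral_const_mul, integral_Ico_eq_integral_Ioc, ← intervalIntegral.integral_of_le
      (by nlinarith), integral_pow, mul_pow, mul_pow]
    field_simp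
  simpa only [e] using this

lemma tendsto_integral_passageIntegrand {c : ℝ} (hc : 0 < c) (m : ℕ) :
    Tendsto (fun t : ℝ => ∫ x in Set.Ioi (0 : ℝ), passageIntegrand c m t x) (𝓝[>] 0)
      (𝓝 (∫ x in Set.Ioi (0 : ℝ), (m + 1) * x ^ m *
        Real.exp (-(2 * c * Real.log (Real.cosh (x / 2)))))) := by
  refine tendsto_integral_filter_of_dominated_convergence (fun x : ℝ => (m + 1) * x ^ m *
    (Real.exp (decayRate c * (1 + 1)) * Real.exp (-(decayRate c * x)))) ?_ ?_
    (integrableOn_passageBound hc m _) ?_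
  · exact Eventually.of_forall fun t => (measurable_passageIntegrand c m t).aestronglyMeasurable
  · filter_upwards [Ioc_mem_nhdsGT (zero_lt_one (α := ℝ))] with t ht
    filter_upwards [ae_restrict_mem measurableSet_Ioi] with x hx
    have hx' : (0 : ℝ) < x := hx
    have hl := decayRate_pos hc
    refine (norm_passageIntegrand_le hc ht.1 m hx'.le).trans ?_
    gcongr
    exact ht.2
  · filter_upwards [ae_restrict_mem measurableSet_Ioi] with x hx
    exact (tendsto_passageGF hc (le_of_lt hx)).const_mul _

/-- Rests on `e^x / (e^x + 1)^2 = 1 / (4 cosh (x/2)^2)`; the prefactor `2^{2c}` cancels the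
`4^{-c}`. -/
lemma integral_limit_eq_rangeJ (c : ℝ) (m : ℕ) :
    ∫ x in Set.Ioi (0 : ℝ), (m + 1) * x ^ m * Real.exp (-(2 * c * Real.log (Real.cosh (x / 2)))) =
      (m + 1) * rangeJ (m + 1) c := by
  rw [rangeJ, ← integral_const_mul, ← integral_const_mul]
  refine setIntegral_congr_fun measurableSet_Ioi fun x _ => ?_
  have h1 : Real.exp x / (Real.exp x + 1) ^ 2 = (2 ^ 2 * Real.cosh (x / 2) ^ 2)⁻¹ := by
    have e : Real.exp x = Real.exp (x / 2) ^ 2 := by rw [← Real.exp_nat_mul]; congr 1; push_cast; ring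
    have h := (Real.exp_pos (x / 2)).ne'
    rw [Real.cosh_eq, Real.exp_neg, e]
    field_simp
  have hch := Real.cosh_pos (x / 2)
  have h2 : (2 : ℝ) ^ (2 * c) * ((2 ^ 2 * Real.cosh (x / 2) ^ 2)⁻¹) ^ c =
      Real.exp (-(2 * c * Real.log (Real.cosh (x / 2)))) := by
    rw [Real.rpow_def_of_pos two_pos, Real.rpow_def_of_pos (by positivity), ← Real.exp_add,
      Real.log_inv, Real.log_mul (by positivity) (by positivity), Real.log_pow, Real.log_pow]
    congr 1
    push_cast
    ring
  simp only [h1]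
  rw [← h2]
  push_cast
  rw [add_sub_cancel_right, Real.rpow_natCast]
  ring

/-! ### The change of variable `δ = log cosh t` -/

lemma one_add_sq_div_two_le_cosh (t : ℝ) : 1 + t ^ 2 / 2 ≤ Real.cosh t := by
  have h : Real.cosh t = 1 + 2 * Real.sinh (t / 2) ^ 2 := by
    conv_lhs => rw [show t = 2 * (t / 2) by ring]
    rw [Real.cosh_two_mul, Real.cosh_sq]
    ring
  have h2 : (t / 2) ^ 2 ≤ Real.sinh (t / 2) ^ 2 := by
    rw [← sq_abs, ← sq_abs (Real.sinh _), Real.abs_sinh]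
    exact pow_le_pow_left₀ (abs_nonneg _) (Real.self_le_sinh_iff.2 (abs_nonneg _)) 2
  rw [h]
  linarith

/-- Squeezed between bounds from `1 + t²/2 ≤ cosh t ≤ exp (t²/2)`. -/
lemma tendsto_log_cosh_div_sq :
    Tendsto (fun t : ℝ => Real.log (Real.cosh t) / t ^ 2) (𝓝[>] 0) (𝓝 (1 / 2)) := by
  have h1 : Tendsto (fun t : ℝ => 1 / 2 / (1 + t ^ 2 / 2)) (𝓝[>] 0) (𝓝 (1 / 2)) := by
    have : ContinuousAt (fun t : ℝ => 1 / 2 / (1 + t ^ 2 / 2)) 0 :=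
      continuousAt_const.div (by fun_prop) (by norm_num)
    have h := this.tendsto
    norm_num at h
    norm_num
    exact h.mono_left nhdsWithin_le_nhds
  refine tendsto_of_tendsto_of_tendsto_of_le_of_le' h1 tendsto_const_nhds ?_ ?_
  · filter_upwards [self_mem_nhdsWithin] with t ht
    have ht' : (0 : ℝ) < t := ht
    rw [le_div_iff₀ (by positivity)]
    have h2 := Real.one_sub_inv_le_log_of_pos (x := 1 + t ^ 2 / 2) (by positivity)
    have h3 := Real.log_le_log (by positivity) (one_add_sq_div_two_le_cosh t)
    refine le_trans (le_of_eq ?_) (h2.trans h3)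
    field_simp
    ring
  · filter_upwards [self_mem_nhdsWithin] with t ht
    have ht' : (0 : ℝ) < t := ht
    rw [div_le_iff₀ (by positivity)]
    have := Real.log_le_log (Real.cosh_pos t) (Real.cosh_le_exp_half_sq t)
    rw [Real.log_exp] at this
    linarith

lemma tendsto_arcosh_exp : Tendsto (fun δ : ℝ => Real.arcosh (Real.exp δ)) (𝓝[>] 0) (𝓝[>] 0) := by
  refine tendsto_nhdsWithin_iff.2 ⟨?_, ?_⟩
  · have h1 : Tendsto Real.arcosh (𝓝[Set.Ici 1] 1) (𝓝 0) := by
      have := Real.continuousOn_arcosh 1 (Set.mem_Ici.2 le_rfl)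
      simpa [ContinuousWithinAt] using this
    refine h1.comp (tendsto_nhdsWithin_iff.2 ⟨?_, ?_⟩)
    · have := Real.continuous_exp.tendsto 0
      rw [Real.exp_zero] at this
      exact this.mono_left nhdsWithin_le_nhds
    · filter_upwards [self_mem_nhdsWithin] with δ hδ
      exact Real.one_le_exp (le_of_lt hδ)
  · filter_upwards [self_mem_nhdsWithin] with δ hδ
    exact Real.arcosh_pos (Real.one_lt_exp_iff.2 hδ)

/-! ### Moments of the range and their generating functions -/

namespace IsOnceReinforcedRandomWalk

variable {Ω : Type*} [MeasurableSpace Ω] {P : Measure Ω} {c : ℝ} {X : ℕ → Ω → ℤ}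

/-- A step raises the range by at most one: through the transition operator, the indicator of range
at least `q + 1` after the step is dominated by that of range at least `q` before it. The
nearest-neighbour property is encoded only in probabilities, so `R_n ≤ n` holds merely almost
surely. -/
lemma tail_eq_zero [IsProbabilityMeasure P] (hX : IsOnceReinforcedRandomWalk P c X) (hc : 0 < c)
    {n r : ℕ} (hr : n < r) : P.real {ω | (r : ℤ) ≤ pathRange (fun k => X k ω) n} = 0 := by
  induction n generalizing r with
  | zero =>
    have : {ω | (r : ℤ) ≤ pathRange (fun k => X k ω) 0} = ∅ := by
      ext ω
      simp [pathRange, runMax, runMin]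
      omega
    rw [this, measureReal_empty]
  | succ n ih =>
    obtain ⟨q, rfl⟩ : ∃ q, r = q + 1 := ⟨r - 1, by omega⟩
    refine le_antisymm ?_ measureReal_nonneg
    rw [← ih (r := q) (by omega), ← hX.integral_ite_pathRange, ← hX.integral_ite_pathRange]
    have hb : ∀ (k : ℕ) (a b d : ℤ), |(if (k : ℤ) ≤ b - d then (1 : ℝ) else 0)| ≤ 1 :=
      fun k a b d => by split_ifs <;> simp
    rw [hX.integral_succ (Φ := fun _ b d => if ((q + 1 : ℕ) : ℤ) ≤ b - d then (1 : ℝ) else 0) hc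
      (hb (q + 1)) n]
    refine integral_mono (hX.integrable_stepMean hc (hb (q + 1)) n)
      (hX.integrable_state (Φ := fun _ b d => if (q : ℤ) ≤ b - d then (1 : ℝ) else 0) (hb q) n)
      fun ω => ?_
    obtain ⟨hp0, hp1⟩ := stepUpProb_mem_Icc hc (fun k => X k ω) n
    have hM := le_runMax (fun k => X k ω) n
    have hm := runMin_le (fun k => X k ω) n
    simp only [stepMean, stepTo]
    push_cast
    split_ifs <;> first | omega | linarith

lemma ae_pathRange_le [IsProbabilityMeasure P] (hX : IsOnceReinforcedRandomWalk P c X) (hc : 0 < c)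
    (n : ℕ) : ∀ᵐ ω ∂P, pathRange (fun k => X k ω) n ≤ n := by
  have h := hX.tail_eq_zero hc (Nat.lt_succ_self n)
  rw [measureReal_eq_zero_iff] at h
  refine (measure_eq_zero_iff_ae_notMem.1 h).mono fun ω hω => ?_
  simp only [Set.mem_ofPred_eq] at hω
  push_cast at hω
  omega

end IsOnceReinforcedRandomWalk

lemma pathRange_nonneg (x : ℕ → ℤ) (n : ℕ) : 0 ≤ pathRange x n := by
  have h1 := le_runMax x n
  have h2 := runMin_le x n
  unfold pathRange
  omega

lemma pathRange_mono (x : ℕ → ℤ) : Monotone (pathRange x) :=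
  monotone_nat_of_le_succ fun n => by
    unfold pathRange
    rw [runMax_succ, runMin_succ]
    omega

namespace IsOnceReinforcedRandomWalk

variable {Ω : Type*} [MeasurableSpace Ω] {P : Measure Ω} {c : ℝ} {X : ℕ → Ω → ℤ}

lemma integrable_pathRange_pow [IsProbabilityMeasure P] (hX : IsOnceReinforcedRandomWalk P c X)
    (hc : 0 < c) (ℓ n : ℕ) : Integrable (fun ω => (pathRange (fun k => X k ω) n : ℝ) ^ ℓ) P := by
  have hmeas : Measurable fun ω => (pathRange (fun k => X k ω) n : ℝ) :=
    (measurable_of_countable (fun z : ℤ => (z : ℝ))).comp (hX.measurable_pathRange n)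
  refine Integrable.of_bound (hmeas.pow_const ℓ).aestronglyMeasurable ((n : ℝ) ^ ℓ) ?_
  filter_upwards [hX.ae_pathRange_le hc n] with ω hω
  have h0 : (0 : ℝ) ≤ pathRange (fun k => X k ω) n := by exact_mod_cast pathRange_nonneg _ n
  rw [norm_pow, Real.norm_of_nonneg h0]
  exact pow_le_pow_left₀ h0 (by exact_mod_cast hω) ℓ

/-- The moments of the range in terms of its tails. -/
lemma hasSum_tail [IsProbabilityMeasure P] (hX : IsOnceReinforcedRandomWalk P c X) (hc : 0 < c)
    (m n : ℕ) :
    HasSum (fun j : ℕ => (((j : ℝ) + 1) ^ (m + 1) - (j : ℝ) ^ (m + 1)) *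
        P.real {ω | ((j + 1 : ℕ) : ℤ) ≤ pathRange (fun k => X k ω) n})
      (∫ ω, (pathRange (fun k => X k ω) n : ℝ) ^ (m + 1) ∂P) := by
  have h : ∫ ω, (pathRange (fun k => X k ω) n : ℝ) ^ (m + 1) ∂P =
      ∑ j ∈ Finset.range n, (((j : ℝ) + 1) ^ (m + 1) - (j : ℝ) ^ (m + 1)) *
        P.real {ω | ((j + 1 : ℕ) : ℤ) ≤ pathRange (fun k => X k ω) n} := by
    simp only [← hX.integral_ite_pathRange, ← integral_const_mul]
    rw [← integral_finsetSum]
    · refine integral_congr_ae ?_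
      filter_upwards [hX.ae_pathRange_le hc n] with ω hω
      obtain ⟨N, hN⟩ := Int.eq_ofNat_of_zero_le (pathRange_nonneg (fun k => X k ω) n)
      have hNn : N ≤ n := by rw [hN] at hω; exact_mod_cast hω
      change _ = ∑ j ∈ Finset.range n, (((j : ℝ) + 1) ^ (m + 1) - (j : ℝ) ^ (m + 1)) *
        if ((j + 1 : ℕ) : ℤ) ≤ pathRange (fun k => X k ω) n then (1 : ℝ) else 0
      rw [hN]
      have e : ∀ j : ℕ, ((j + 1 : ℕ) : ℤ) ≤ (N : ℤ) ↔ j ∈ Finset.range N := fun j => by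
        rw [Finset.mem_range]; omega
      simp only [e, mul_ite, mul_one, mul_zero]
      rw [Finset.sum_ite_mem, Finset.inter_eq_right.2 (Finset.range_mono hNn)]
      -- With `N` the value of the range, the weights up to `N` telescope to `N^(m+1)`.
      have := Finset.sum_range_sub (fun j : ℕ => (j : ℝ) ^ (m + 1)) N
      push_cast at this ⊢
      rw [this]
      simp
    · intro j _
      exact (hX.integrable_state (Φ := fun _ b d => if ((j + 1 : ℕ) : ℤ) ≤ b - d then (1 : ℝ) else 0)
        (B := 1) (fun a b d => by split_ifs <;> simp) n).const_mul _
  rw [h]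
  refine hasSum_sum_of_ne_finset_zero fun j hj => ?_
  rw [hX.tail_eq_zero hc (by simpa [Nat.lt_succ_iff] using hj), mul_zero]

/-- The generating function of the moments of the range. -/
lemma hasSum_pow_mul_moment [IsProbabilityMeasure P] (hX : IsOnceReinforcedRandomWalk P c X)
    (hc : 0 < c) {t : ℝ} (ht : 0 < t) (m : ℕ) :
    HasSum (fun n : ℕ => (∫ ω, (pathRange (fun k => X k ω) n : ℝ) ^ (m + 1) ∂P) *
        (Real.cosh t)⁻¹ ^ n)
      ((1 - (Real.cosh t)⁻¹)⁻¹ * (∫ x in Set.Ioi (0 : ℝ), passageIntegrand c m t x) /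
        t ^ (m + 1)) := by
  set s := (Real.cosh t)⁻¹ with hs
  have hs0 : 0 < s := inv_pos.2 (Real.cosh_pos t)
  let w : ℕ → ℝ := fun j => ((j : ℝ) + 1) ^ (m + 1) - (j : ℝ) ^ (m + 1)
  have hw : ∀ j, 0 ≤ w j := fun j =>
    sub_nonneg.2 (pow_le_pow_left₀ (by positivity) (by linarith) _)
  let f : ℕ × ℕ → ℝ := fun q =>
    w q.1 * (s ^ q.2 * P.real {ω | ((q.1 + 1 : ℕ) : ℤ) ≤ pathRange (fun k => X k ω) q.2})
  have hf0 : 0 ≤ f := fun q => mul_nonneg (hw _) (mul_nonneg (by positivity) measureReal_nonneg)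
  have hrow : ∀ j, HasSum (fun n => f (j, n)) (w j * (passageGF c t (j + 1) / (1 - s))) :=
    fun j => (hX.hasSum_pow_mul_tail hc ht (j + 1)).mul_left _
  have hG : HasSum (fun j => w j * (passageGF c t (j + 1) / (1 - s)))
      ((1 - s)⁻¹ * (∫ x in Set.Ioi (0 : ℝ), passageIntegrand c m t x) / t ^ (m + 1)) := by
    have h := (hasSum_passageGF hc ht m).mul_left ((1 - s)⁻¹ / t ^ (m + 1))
    have ht' : t ^ (m + 1) ≠ 0 := by positivity
    have e : ∀ j, w j * (passageGF c t (j + 1) / (1 - s)) =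
        (1 - s)⁻¹ / t ^ (m + 1) * (t ^ (m + 1) * (w j * passageGF c t (j + 1))) := fun j => by
      field_simp
    simp only [e]
    rw [mul_div_right_comm]
    exact h
  -- Tonelli for a nonnegative double series: sum over time first to get the passage generating
  -- functions, over levels first to get the moments.
  have hsum : Summable f := (summable_prod_of_nonneg hf0).2
    ⟨fun j => (hrow j).summable, by simpa only [(hrow _).tsum_eq] using hG.summable⟩
  have htot := hsum.hasSum.prod_fiberwise hrow
  have hswap := (Equiv.prodComm ℕ ℕ).hasSum_iff.2 (hsum.hasSum)
  refine HasSum.prod_fiberwise (f := f ∘ Equiv.prodComm ℕ ℕ) ?_ fun n => ?_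
  · rw [← htot.unique hG]; exact hswap
  · have := (hX.hasSum_tail hc m n).mul_right (s ^ n)
    have e : ∀ j, (f ∘ Equiv.prodComm ℕ ℕ) (n, j) =
        (((j : ℝ) + 1) ^ (m + 1) - (j : ℝ) ^ (m + 1)) *
          P.real {ω | ((j + 1 : ℕ) : ℤ) ≤ pathRange (fun k => X k ω) n} * s ^ n := fun j => by
      simp only [f, w, Function.comp, Equiv.prodComm_apply, Prod.swap]
      ring
    simpa only [e] using this

end IsOnceReinforcedRandomWalk

/-- Positivity is what turns convergence of the moments into convergence of the ratio to `1`. -/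
lemma rangeJ_pos {ℓ : ℕ} (hℓ : 1 ≤ ℓ) {c : ℝ} (hc : 0 < c) : 0 < rangeJ ℓ c := by
  obtain ⟨m, rfl⟩ : ∃ m, ℓ = m + 1 := ⟨ℓ - 1, by omega⟩
  have h := integral_limit_eq_rangeJ c m
  have hm : (0 : ℝ) < m + 1 := by positivity
  refine pos_of_mul_pos_right (a := (m + 1 : ℝ)) ?_ hm.le
  rw [← h, setIntegral_pos_iff_support_of_nonneg_ae]
  · have : Set.Ioi (0 : ℝ) ⊆ (Function.support fun x : ℝ => (m + 1) * x ^ m *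
        Real.exp (-(2 * c * Real.log (Real.cosh (x / 2))))) ∩ Set.Ioi 0 := by
      intro x hx
      have hx' : (0 : ℝ) < x := hx
      refine ⟨?_, hx⟩
      simp only [Function.mem_support]
      positivity
    exact lt_of_lt_of_le (by simp) (measure_mono this)
  · filter_upwards [ae_restrict_mem measurableSet_Ioi] with x hx
    have hx' : (0 : ℝ) < x := hx
    simp only [Pi.zero_apply]
    positivity
  · refine Integrable.mono' (integrableOn_passageBound hc m (Real.exp (decayRate c * (1 + 1))))
      (by
        refine Measurable.aestronglyMeasurable ?_
        exact ((measurable_const.mul (measurable_id.pow_const m)).mul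
          (Real.measurable_exp.comp (measurable_const.mul (Real.measurable_log.comp
            (Real.measurable_cosh.comp (measurable_id.div_const 2)))).neg))) ?_
    filter_upwards [ae_restrict_mem measurableSet_Ioi] with x hx
    have hx' : (0 : ℝ) < x := hx
    -- Integrability of the limit is inherited: it is a pointwise limit of functions under a common
    -- integrable bound.
    refine le_of_tendsto (((tendsto_passageGF hc hx'.le).const_mul ((m + 1) * x ^ m)).norm) ?_
    filter_upwards [Ioc_mem_nhdsGT (zero_lt_one (α := ℝ))] with t ht
    have hl := decayRate_pos hc
    refine (norm_passageIntegrand_le hc ht.1 m hx'.le).trans ?_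
    gcongr
    exact ht.2

/-! ### Asymptotics of the moments -/

namespace IsOnceReinforcedRandomWalk

variable {Ω : Type*} [MeasurableSpace Ω] {P : Measure Ω} {c : ℝ} {X : ℕ → Ω → ℤ}

lemma hasSum_moment_mul_exp [IsProbabilityMeasure P] (hX : IsOnceReinforcedRandomWalk P c X)
    (hc : 0 < c) (m : ℕ) {δ : ℝ} (hδ : 0 < δ) :
    HasSum (fun n : ℕ => (∫ ω, (pathRange (fun k => X k ω) n : ℝ) ^ (m + 1) ∂P) *
        Real.exp (-(δ * n)))
      ((1 - Real.exp (-δ))⁻¹ * (∫ x in Set.Ioi (0 : ℝ),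
        passageIntegrand c m (Real.arcosh (Real.exp δ)) x) /
        Real.arcosh (Real.exp δ) ^ (m + 1)) := by
  have h1 : 1 < Real.exp δ := Real.one_lt_exp_iff.2 hδ
  have h := hX.hasSum_pow_mul_moment hc (Real.arcosh_pos h1) m
  rw [Real.cosh_arcosh h1.le, ← Real.exp_neg] at h
  have e : ∀ n : ℕ, Real.exp (-δ) ^ n = Real.exp (-(δ * n)) := fun n => by
    rw [← Real.exp_nat_mul]; congr 1; ring
  simpa only [e] using h

lemma tendsto_moment [IsProbabilityMeasure P] (hX : IsOnceReinforcedRandomWalk P c X)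
    (hc : 0 < c) (m : ℕ) :
    Tendsto (fun n : ℕ => (∫ ω, (pathRange (fun k => X k ω) n : ℝ) ^ (m + 1) ∂P) /
        (n : ℝ) ^ (((m + 1 : ℕ) : ℝ) / 2)) atTop
      (𝓝 ((1 / 2 : ℝ) ^ (((m + 1 : ℕ) : ℝ) / 2) * ((m + 1) * rangeJ (m + 1) c) /
        Real.Gamma (((m + 1 : ℕ) : ℝ) / 2 + 1))) := by
  set ρ : ℝ := ((m + 1 : ℕ) : ℝ) / 2 with hρ
  have hρ0 : 0 ≤ ρ := by positivity
  refine tendsto_div_rpow_of_tendsto_abel (fun n => integral_nonneg fun ω => ?_) ?_ hρ0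
    (fun δ hδ => (hX.hasSum_moment_mul_exp hc m hδ).summable) ?_
  · have : (0 : ℝ) ≤ pathRange (fun k => X k ω) n := by exact_mod_cast pathRange_nonneg _ n
    positivity
  · intro i j hij
    refine integral_mono (hX.integrable_pathRange_pow hc _ i) (hX.integrable_pathRange_pow hc _ j)
      fun ω => ?_
    have h0 : (0 : ℝ) ≤ pathRange (fun k => X k ω) i := by exact_mod_cast pathRange_nonneg _ i
    have h1 : (pathRange (fun k => X k ω) i : ℝ) ≤ pathRange (fun k => X k ω) j := by
      exact_mod_cast pathRange_mono _ hij
    exact pow_le_pow_left₀ h0 h1 _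
  · have h1 := (tendsto_integral_passageIntegrand hc m).comp tendsto_arcosh_exp
    rw [integral_limit_eq_rangeJ] at h1
    have h2 := (tendsto_log_cosh_div_sq.comp tendsto_arcosh_exp).rpow_const (p := ρ) (Or.inr hρ0)
    have h3 := (tendsto_div_one_sub_exp_neg.mul h2).mul h1
    rw [one_mul] at h3
    -- For `t = arcosh (e^δ)`, so that `δ = log cosh t` and `t^(2ρ) = t^(m+1)`, the normalised Abel
    -- sum factors as `δ / (1 - e^{-δ})`, `(δ / t²)^ρ` and the integral; these tend to `1`, `2^{-ρ}`
    -- and `(m+1) J_{m+1}(c)`.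
    refine h3.congr' ?_
    filter_upwards [self_mem_nhdsWithin] with δ hδ
    have hδ' : (0 : ℝ) < δ := hδ
    have he : 1 < Real.exp δ := Real.one_lt_exp_iff.2 hδ'
    have ht := Real.arcosh_pos he
    rw [(hX.hasSum_moment_mul_exp hc m hδ').tsum_eq]
    simp only [Function.comp]
    rw [Real.cosh_arcosh he.le, Real.log_exp]
    set t := Real.arcosh (Real.exp δ)
    have e1 : (δ / t ^ 2) ^ ρ = δ ^ ρ / t ^ (m + 1) := by
      rw [Real.div_rpow hδ'.le (by positivity), ← Real.rpow_natCast t 2, ← Real.rpow_mul ht.le, hρ,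
        show ((2 : ℕ) : ℝ) * (((m + 1 : ℕ) : ℝ) / 2) = ((m + 1 : ℕ) : ℝ) by push_cast; ring,
        Real.rpow_natCast]
    rw [e1, Real.rpow_add hδ', Real.rpow_one]
    ring

lemma seqEquiv_moment [IsProbabilityMeasure P] (hX : IsOnceReinforcedRandomWalk P c X)
    (hc : 0 < c) {ℓ : ℕ} (hℓ : 1 ≤ ℓ) :
    SeqEquiv (fun n => ∫ ω, ((pathRange (fun k => X k ω) n : ℝ) / Real.sqrt (n : ℝ)) ^ ℓ ∂P)
      (fun _ => 1 / ((2 : ℝ) ^ (((ℓ : ℝ) - 2) / 2) * Real.Gamma ((ℓ : ℝ) / 2)) * rangeJ ℓ c) := by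
  have hJ := rangeJ_pos hℓ hc
  have hℓ' : (0 : ℝ) < ℓ := by exact_mod_cast hℓ
  have hΓ : 0 < Real.Gamma ((ℓ : ℝ) / 2) := Real.Gamma_pos_of_pos (by positivity)
  have h2 : (0 : ℝ) < (2 : ℝ) ^ (((ℓ : ℝ) - 2) / 2) := by positivity
  have h : Tendsto (fun n : ℕ => ∫ ω, ((pathRange (fun k => X k ω) n : ℝ) / Real.sqrt (n : ℝ)) ^ ℓ
      ∂P) atTop
      (𝓝 (1 / ((2 : ℝ) ^ (((ℓ : ℝ) - 2) / 2) * Real.Gamma ((ℓ : ℝ) / 2)) * rangeJ ℓ c)) := by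
    obtain ⟨m, rfl⟩ : ∃ m, ℓ = m + 1 := ⟨ℓ - 1, by omega⟩
    have hlim := hX.tendsto_moment hc m
    have e : (1 / 2 : ℝ) ^ (((m + 1 : ℕ) : ℝ) / 2) * ((m + 1) * rangeJ (m + 1) c) /
        Real.Gamma (((m + 1 : ℕ) : ℝ) / 2 + 1) =
        1 / ((2 : ℝ) ^ ((((m + 1 : ℕ) : ℝ) - 2) / 2) * Real.Gamma (((m + 1 : ℕ) : ℝ) / 2)) *
          rangeJ (m + 1) c := by
      have hp : (1 / 2 : ℝ) ^ (((m + 1 : ℕ) : ℝ) / 2) =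
          1 / (2 * (2 : ℝ) ^ ((((m + 1 : ℕ) : ℝ) - 2) / 2)) := by
        rw [Real.div_rpow zero_le_one zero_le_two, Real.one_rpow,
          show ((m + 1 : ℕ) : ℝ) / 2 = 1 + (((m + 1 : ℕ) : ℝ) - 2) / 2 by ring,
          Real.rpow_add two_pos, Real.rpow_one]
      -- By `Γ(ρ + 1) = ρ Γ(ρ)` with `ρ = (m+1)/2`, the factor `m + 1` cancels and leaves a `2`.
      rw [hp, Real.Gamma_add_one (by positivity)]
      have hm : (m + 1 : ℝ) ≠ 0 := by positivity
      push_cast at hΓ h2 ⊢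
      field_simp
    rw [e] at hlim
    refine hlim.congr fun n => ?_
    simp only [div_pow]
    rw [integral_div]
    congr 1
    rw [Real.sqrt_eq_rpow, ← Real.rpow_natCast, ← Real.rpow_mul (Nat.cast_nonneg n)]
    congr 1
    ring
  have := h.div_const (1 / ((2 : ℝ) ^ (((ℓ : ℝ) - 2) / 2) * Real.Gamma ((ℓ : ℝ) / 2)) * rangeJ ℓ c)
  rwa [div_self (by positivity)] at this

end IsOnceReinforcedRandomWalk

theorem theorem1 {Ω : Type*} [MeasurableSpace Ω] (P : Measure Ω) [IsProbabilityMeasure P]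
    (c : ℝ) (hc : 0 < c) (X : ℕ → Ω → ℤ) (hX : IsOnceReinforcedRandomWalk P c X) :
    (∀ ℓ : ℕ, 1 ≤ ℓ →
      SeqEquiv
        (fun n => ∫ ω, ((pathRange (fun k => X k ω) n : ℝ) / Real.sqrt (n : ℝ)) ^ ℓ ∂P)
        (fun _ => 1 / ((2 : ℝ) ^ (((ℓ : ℝ) - 2) / 2) * Real.Gamma ((ℓ : ℝ) / 2)) * rangeJ ℓ c)) ∧
    SeqEquiv
      (fun n => ∫ ω, (pathRange (fun k => X k ω) n : ℝ) / Real.sqrt (n : ℝ) ∂P)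
      (fun _ => Real.sqrt (2 / Real.pi) * rangeJ 1 c) ∧
    SeqEquiv
      (fun n => ∫ ω, (pathRange (fun k => X k ω) n : ℝ) ^ 2 / (n : ℝ) ∂P)
      (fun _ => rangeJ 2 c) := by
  refine ⟨fun ℓ hℓ => hX.seqEquiv_moment hc hℓ, ?_, ?_⟩
  · have h := hX.seqEquiv_moment hc le_rfl
    have e : 1 / ((2 : ℝ) ^ ((((1 : ℕ) : ℝ) - 2) / 2) * Real.Gamma (((1 : ℕ) : ℝ) / 2)) =
        Real.sqrt (2 / Real.pi) := by
      rw [Nat.cast_one, Real.Gamma_one_half_eq, Real.sqrt_div zero_le_two,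
        show ((1 : ℝ) - 2) / 2 = -(1 / 2) by norm_num, Real.rpow_neg zero_le_two,
        ← Real.sqrt_eq_rpow]
      field_simp
    simpa only [e, pow_one] using h
  · have h := hX.seqEquiv_moment hc one_le_two
    have e : 1 / ((2 : ℝ) ^ ((((2 : ℕ) : ℝ) - 2) / 2) * Real.Gamma (((2 : ℕ) : ℝ) / 2)) = 1 := by
      norm_num
    have e2 : ∀ (n : ℕ) (y : ℝ), (y / Real.sqrt n) ^ 2 = y ^ 2 / n := fun n y => by
      rw [div_pow, Real.sq_sqrt (Nat.cast_nonneg n)]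
    simpa only [e, e2, one_mul] using h
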